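/- There is a deterministic algorithm that runs in time polynomial in the bit length of its input and does the following. The input consists of a positive integer $N$, the prime factorization $N=\prod_i q_i^{k_i}$ (the list of pairs $(q_i,k_i)$ with distinct primes $q_i$ and exponents $k_i\ge 1$), and a table of structure constants $c_{ijk}\in\mathbb{Z}/N\mathbb{Z}$, $1\le i,j,k\le 4$, written as residues in $[0,N)$, of a ring $A$ that is isomorphic to $M_2(\mathbb{Z}/N\mathbb{Z})$: that is, $A$ has a basis $b_1,\dots,b_4$ as a $\mathbb{Z}/N\mathbb{Z}$-module with $b_ib_j=\sum_k c_{ijk}b_k$. The output is an explicit isomorphism $\varphi\colon A\to M_2(\mathbb{Z}/N\mathbb{Z})$ of $\mathbb{Z}/N\mathbb{Z}$-algebras, given by the four matrices $\varphi(b_1),\dots,\varphi(b_4)$ with entries written as residues in $[0,N)$. (Running time is the bit cost of a program for a random access machine on natural numbers: each memory access is charged for the binary length of the address and the content, and each addition, subtraction, multiplication or division with remainder of $x$ and $y$ is charged $(1+\mathrm{size}(x))(1+\mathrm{size}(y))$, where $\mathrm{size}$ denotes the binary length.) -/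

import Mathlib

namespace RAM

/-- A memory state of the machine: `s a i` is the natural number in cell `i` of array `a`.
A program mentions finitely many arrays; cell `0` of an array can serve as a scalar variable. -/
abbrev State := ℕ → ℕ → ℕ

/-- Arithmetic operations on natural numbers: addition, truncated subtraction, multiplication,
integer division and remainder (with `x / 0 = 0` and `x % 0 = x`). -/
inductive Op
  | add | sub | mul | div | mod

def Op.eval : Op → ℕ → ℕ → ℕ
  | .add, x, y => x + y
  | .sub, x, y => x - y
  | .mul, x, y => x * y
  | .div, x, y => x / y
  | .mod, x, y => x % y

/-- Expressions: constants, the content of a cell whose index is computed (indirect addressing),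
and arithmetic. -/
inductive Expr
  | const (n : ℕ)
  | read (a : ℕ) (i : Expr)
  | bin (o : Op) (e f : Expr)

def Expr.eval (s : State) : Expr → ℕ
  | .const n => n
  | .read a i => s a (i.eval s)
  | .bin o e f => o.eval (e.eval s) (f.eval s)

/-- Bit cost of evaluating an expression (`Nat.size` is the binary length). A memory access pays
for the length of the index and of the content, an arithmetic operation on `x` and `y` pays the
schoolbook cost `(1 + size x) * (1 + size y)`. -/
def Expr.cost (s : State) : Expr → ℕ
  | .const n => 1 + n.size
  | .read a i => i.cost s + (1 + (i.eval s).size + (s a (i.eval s)).size)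
  | .bin _ e f => e.cost s + f.cost s + (1 + (e.eval s).size) * (1 + (f.eval s).size)

/-- Programs of a deterministic random access machine, with structured control flow. A condition
counts as true when its value is nonzero. -/
inductive Prog
  | skip
  | store (a : ℕ) (i e : Expr)
  | seq (p q : Prog)
  | ite (c : Expr) (p q : Prog)
  | loop (c : Expr) (p : Prog)

def State.write (s : State) (a i v : ℕ) : State :=
  Function.update s a (Function.update (s a) i v)

/-- `Exec p s s' t`: started in the state `s`, the program `p` halts in the state `s'`, and the
total bit cost of the run is `t`. A program that does not halt from `s` has no such `s'`, `t`. -/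
inductive Exec : Prog → State → State → ℕ → Prop
  | skip (s : State) : Exec .skip s s 1
  | store (s : State) (a : ℕ) (i e : Expr) :
      Exec (.store a i e) s (s.write a (i.eval s) (e.eval s))
        (i.cost s + e.cost s + (1 + (i.eval s).size + (e.eval s).size))
  | seq {p q : Prog} {s s' s'' : State} {t t' : ℕ} :
      Exec p s s' t → Exec q s' s'' t' → Exec (.seq p q) s s'' (t + t')
  | ite_true {c : Expr} {p q : Prog} {s s' : State} {t : ℕ} :
      c.eval s ≠ 0 → Exec p s s' t → Exec (.ite c p q) s s' (c.cost s + 1 + t)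
  | ite_false {c : Expr} {p q : Prog} {s s' : State} {t : ℕ} :
      c.eval s = 0 → Exec q s s' t → Exec (.ite c p q) s s' (c.cost s + 1 + t)
  | loop_true {c : Expr} {p : Prog} {s s' s'' : State} {t t' : ℕ} :
      c.eval s ≠ 0 → Exec p s s' t → Exec (.loop c p) s' s'' t' →
      Exec (.loop c p) s s'' (c.cost s + 1 + t + t')
  | loop_false {c : Expr} {p : Prog} {s : State} :
      c.eval s = 0 → Exec (.loop c p) s s (c.cost s + 1)

/-- The machine is deterministic: final state and running time are unique. -/
theorem Exec.deterministic {p : Prog} {s s₁ s₂ : State} {t₁ t₂ : ℕ}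
    (h₁ : Exec p s s₁ t₁) (h₂ : Exec p s s₂ t₂) : s₁ = s₂ ∧ t₁ = t₂ := by
  induction h₁ generalizing s₂ t₂ with
  | skip s => cases h₂; exact ⟨rfl, rfl⟩
  | store s a i e => cases h₂; exact ⟨rfl, rfl⟩
  | seq _ _ ih ih' =>
    cases h₂ with
    | seq k k' =>
      obtain ⟨rfl, rfl⟩ := ih k
      obtain ⟨rfl, rfl⟩ := ih' k'
      exact ⟨rfl, rfl⟩
  | ite_true hc _ ih =>
    cases h₂ with
    | ite_true _ k => obtain ⟨rfl, rfl⟩ := ih k; exact ⟨rfl, rfl⟩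
    | ite_false hc' _ => exact absurd hc' hc
  | ite_false hc _ ih =>
    cases h₂ with
    | ite_true hc' _ => exact absurd hc hc'
    | ite_false _ k => obtain ⟨rfl, rfl⟩ := ih k; exact ⟨rfl, rfl⟩
  | loop_true hc _ _ ih ih' =>
    cases h₂ with
    | loop_true _ k k' =>
      obtain ⟨rfl, rfl⟩ := ih k
      obtain ⟨rfl, rfl⟩ := ih' k'
      exact ⟨rfl, rfl⟩
    | loop_false hc' => exact absurd hc' hc
  | loop_false hc =>
    cases h₂ with
    | loop_true hc' _ _ => exact absurd hc hc'
    | loop_false _ => exact ⟨rfl, rfl⟩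

/-- Initial state: the input words stand in array `0`, their number in cell `0` of array `1`,
and all other cells are `0`. -/
def inputState (w : List ℕ) : State
  | 0, i => w.getD i 0
  | 1, 0 => w.length
  | _, _ => 0

/-- The output words are read off array `2`, their number off cell `0` of array `3`. -/
def State.output (s : State) : List ℕ :=
  (List.range (s 3 0)).map (s 2)

/-- Bit length of a list of words (binary length of each word plus one separator). -/
def bitLength (w : List ℕ) : ℕ :=
  (w.map fun x => x.size + 1).sum

end RAM

/-- `F` is the list of pairs `(q, k)`, in some order, of the prime factorization `N = ∏ q ^ k`,
with distinct primes `q` and exponents `k ≥ 1` (so that `N ≥ 1`). -/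
def IsPrimeFactorization (N : ℕ) (F : List (ℕ × ℕ)) : Prop :=
  (∀ f ∈ F, f.1.Prime ∧ 1 ≤ f.2) ∧ (F.map Prod.fst).Nodup ∧
    (F.map fun f => f.1 ^ f.2).prod = N

/-- Structure constants with respect to a basis: `b i * b j = ∑ k, c i j k • b k`. -/
noncomputable def structureConstants {R A ι : Type*} [CommRing R] [Ring A] [Algebra R A]
    (b : Module.Basis ι R A) (i j k : ι) : R :=
  b.repr (b i * b j) k

/-- Input words: `N`, then the 64 structure constants as residues in `[0, N)` in lexicographic
order of the indices, then the factorization of `N` as `q₁, k₁, q₂, k₂, …`. -/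
def encodeInput (N : ℕ) (c : Fin 4 → Fin 4 → Fin 4 → ZMod N) (F : List (ℕ × ℕ)) : List ℕ :=
  N :: ((List.finRange 4).flatMap fun i => (List.finRange 4).flatMap fun j =>
      (List.finRange 4).map fun k => (c i j k).val) ++
    F.flatMap fun f => [f.1, f.2]

/-- Four matrices as 16 words: the entries of each as residues in `[0, N)`, row by row. -/
def encodeMatrices (N : ℕ) (M : Fin 4 → Matrix (Fin 2) (Fin 2) (ZMod N)) : List ℕ :=
  (List.finRange 4).flatMap fun i => (List.finRange 2).flatMap fun r =>
    (List.finRange 2).map fun s => (M i r s).val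

/-!
The theorem has two halves: an algorithm that splits the algebra, and a proof that it runs in
polynomial time on the random access machine.

*Running time.* `RAM.PolyTime f` says that a function between types of tuples of words is computed
by programs that work above a given array and leave everything below untouched. Such functions are
closed under composition, pairing, arithmetic, case distinction and, the essential case, iteration
for as many rounds as a word has bits, provided that the intermediate words stay short
(`PolyTime.iterate`). The algorithm is written as an ordinary function on words, every loop of it
being such an iteration whose words stay below an explicit bound; `PolyTime.splitting` follows
compositionally, and `PolyTime.exists_prog` turns it into a program of the required format.

*Algorithm.* Let `p` be a prime factor of `N` and consider the algebra modulo `p`, which is the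
algebra of two-by-two matrices over a field. Iterated commutators do not all vanish
(`exists_commutator_ne_zero`), so there are basis vectors with `j = [i, b k] ≠ 0` for
`i = [b m, b n]`. Both `i` and `j` have trace zero; hence `i² = a` and `j² = b` are scalars, and
`i j = -j i`; the prime `2` is no exception. If `a = 0` or `b = 0`, then `i` or `j` is a zero
divisor.

Otherwise one has to solve a quadratic equation deterministically, although no quadratic nonresidue
is at hand. This is possible because any one of three square roots suffices. Halve the exponent
`p - 1` as long as it is even and its half still annihilates both `a` and `b`. If this ends with an
odd exponent, then `a` has an explicit root. If not, for half of the final exponent `a` and `b` have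
powers `±1`, not both `1`, and an element with power `-1` serves as the nonresidue in the
Tonelli–Shanks algorithm for an element with power `1`: one of `a`, `b`, `a b` gets a root `s`
(`selectRoot_spec`). In the first two cases, `s - i` or `s - j` is a zero divisor. In the last one,
a representation `a = u² + v²` is needed, since then `u s + s i + v i j` has norm
`s² (u² - a + v²) = 0`. It is built along the binary digits of `a`: doubling is easy, and for adding
`1` to `m = u² + v²` one applies the selective root to `m` and `m + 1`; a root of `m`, of `m + 1`
or of `m (m + 1)` represents `m + 1` in each case (`twoSq_spec`).

A zero divisor `z` satisfies `z x z = tr (z x) z`, so `z b m / t` is an idempotent of rank one for a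
suitable basis vector, and Newton iteration lifts it to an idempotent `e` modulo the power `Q` of
`p`. Some product `e b i (1 - e) · (1 - e) b j e` is a unit times `e`; its suitably scaled factors
complete `e` to a system of matrix units, and coordinates with respect to these give an isomorphism
modulo `Q` (`exists_algHom_trace`, `exists_localSplitting`). The matrices for the different prime
powers are combined by the Chinese remainder theorem, with `(N / Q) ^ φ(Q)` as the idempotents
(`iterate_mainStep`). Finally, `exists_algEquiv` shows that the result is an isomorphism, because it
is one modulo every prime power.
-/

namespace RAM

/-! ### Polynomial-time functions between types of tuples -/

/-- A type whose elements are stored in memory as finitely many words, each in cell `0` of some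
array (a *register*). `inp x` lists the sequences which the read-only input array `0` has to hold;
it is empty for plain tuples of words and a singleton for the type `ℕ → ℕ` of input tapes. -/
class Data (α : Type) where
  /-- The positions of the words. -/
  Idx : Type
  fintypeIdx : Fintype Idx
  /-- The words of an element. -/
  words : α → Idx → ℕ
  /-- The required contents of array `0`. -/
  inp : α → Set (ℕ → ℕ)

instance {α : Type} [Data α] : Fintype (Data.Idx α) := Data.fintypeIdx

/-- Plain tuples of words, which do not refer to the input tape. -/
class FlatData (α : Type) [Data α] : Prop where
  inp_eq : ∀ x : α, Data.inp x = ∅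

instance : Data ℕ := ⟨Unit, inferInstance, fun x _ => x, fun _ => ∅⟩
instance : FlatData ℕ := ⟨fun _ => rfl⟩
instance : Data (ℕ → ℕ) := ⟨Empty, inferInstance, fun _ => Empty.elim, fun x => {x}⟩
instance {α β : Type} [Data α] [Data β] : Data (α × β) :=
  ⟨Data.Idx α ⊕ Data.Idx β, inferInstance,
    fun x => Sum.elim (Data.words x.1) (Data.words x.2), fun x => Data.inp x.1 ∪ Data.inp x.2⟩
instance {α β : Type} [Data α] [Data β] [FlatData α] [FlatData β] : FlatData (α × β) :=
  ⟨fun x => by simp [Data.inp, FlatData.inp_eq]⟩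
instance {α : Type} [Data α] {n : ℕ} : Data (Fin n → α) :=
  ⟨Fin n × Data.Idx α, inferInstance, fun x j => Data.words (x j.1) j.2,
    fun x => ⋃ i, Data.inp (x i)⟩
instance {α : Type} [Data α] [FlatData α] {n : ℕ} : FlatData (Fin n → α) :=
  ⟨fun x => by simp [Data.inp, FlatData.inp_eq]⟩

/-- The state `s` holds `x` in the registers `l`. -/
def Holds {α : Type} [Data α] (s : State) (l : Data.Idx α → ℕ) (x : α) : Prop :=
  (∀ j, s (l j) 0 = Data.words x j) ∧ ∀ m ∈ Data.inp x, s 0 = m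

/-- Every word of `x`, including the input tape if `x` contains it, has at most `S` bits. -/
def SizeLE {α : Type} [Data α] (S : ℕ) (x : α) : Prop :=
  (∀ j, (Data.words x j).size ≤ S) ∧ ∀ m ∈ Data.inp x, ∀ i, (m i).size ≤ S

/-- Every word of `x` is at most `W`. -/
def WordsLE {α : Type} [Data α] (W : ℕ) (x : α) : Prop := ∀ j, Data.words x j ≤ W

theorem WordsLE.sizeLE {α : Type} [Data α] [FlatData α] {W S : ℕ} {x : α} (h : WordsLE W x)
    (hS : W.size ≤ S) : SizeLE S x :=
  ⟨fun j => (Nat.size_le_size (h j)).trans hS, by simp [FlatData.inp_eq]⟩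

theorem SizeLE.mono {α : Type} [Data α] {S S' : ℕ} {x : α} (h : SizeLE S x) (hS : S ≤ S') :
    SizeLE S' x :=
  ⟨fun j => (h.1 j).trans hS, fun m hm i => (h.2 m hm i).trans hS⟩

/-- `f` is computed in polynomial time by programs that follow a stack discipline: for all input
registers `l` below `o` there is a program that leaves the arrays below `o` alone and puts the
result into registers `l'` below `o'`, within a time polynomial in the largest bit length of the
words of the argument. The length of the result is polynomially bounded too. The arrays below `4`
have a meaning for input and output; only `0 < o` is needed here, to protect the input tape. -/
@[fun_prop]
structure PolyTime {α β : Type} [Data α] [Data β] (f : α → β) : Prop where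
  size : ∃ B : Polynomial ℕ, ∀ S x, SizeLE S x → SizeLE (B.eval S) (f x)
  prog : ∀ (l : Data.Idx α → ℕ) (o : ℕ), 0 < o → (∀ j, l j < o) →
    ∃ (p : Prog) (l' : Data.Idx β → ℕ) (o' : ℕ) (T : Polynomial ℕ), o ≤ o' ∧ (∀ j, l' j < o') ∧
      ∀ S x s, Holds s l x → SizeLE S x →
        ∃ s' t, Exec p s s' t ∧ t ≤ T.eval S ∧ Holds s' l' (f x) ∧ ∀ a < o, s' a = s a

variable {α β γ δ : Type} [Data α] [Data β] [Data γ] [Data δ]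

@[fun_prop]
theorem PolyTime.id : PolyTime fun x : α => x where
  size := ⟨.X, fun S x hx => by rwa [Polynomial.eval_X]⟩
  prog l o _ hl := ⟨.skip, l, o, 1, le_rfl, hl, fun S x s hs _ =>
    ⟨s, 1, .skip s, by simp, hs, fun _ _ => rfl⟩⟩

/-- Selecting and rearranging words costs nothing, as results may stay where they are. -/
theorem PolyTime.of_words {f : α → β} {h : α → γ} (hh : PolyTime h)
    (g : Data.Idx β → Data.Idx γ) (hw : ∀ x j, Data.words (f x) j = Data.words (h x) (g j))
    (hi : ∀ x, Data.inp (f x) ⊆ Data.inp (h x)) : PolyTime f where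
  size := by
    obtain ⟨B, hB⟩ := hh.size
    exact ⟨B, fun S x hx => ⟨fun j => hw x j ▸ (hB S x hx).1 _,
      fun m hm => (hB S x hx).2 m (hi x hm)⟩⟩
  prog l o ho hl := by
    obtain ⟨p, l', o', T, h1, h2, h3⟩ := hh.prog l o ho hl
    refine ⟨p, l' ∘ g, o', T, h1, fun j => h2 _, fun S x s hs hx => ?_⟩
    obtain ⟨s', t, e, ht, hs', hp⟩ := h3 S x s hs hx
    exact ⟨s', t, e, ht, ⟨fun j => by rw [hw, ← hs'.1]; rfl, fun m hm => hs'.2 m (hi x hm)⟩, hp⟩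

@[fun_prop]
theorem PolyTime.comp {g : β → γ} {f : α → β} (hg : PolyTime g) (hf : PolyTime f) :
    PolyTime fun x => g (f x) where
  size := by
    obtain ⟨B, hB⟩ := hf.size
    obtain ⟨C, hC⟩ := hg.size
    exact ⟨C.comp B, fun S x hx => by rw [Polynomial.eval_comp]; exact hC _ _ (hB _ _ hx)⟩
  prog l o ho hl := by
    obtain ⟨B, hB⟩ := hf.size
    obtain ⟨p, l₁, o₁, T, h1, h2, h3⟩ := hf.prog l o ho hl
    obtain ⟨q, l₂, o₂, U, k1, k2, k3⟩ := hg.prog l₁ o₁ (ho.trans_le h1) h2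
    refine ⟨.seq p q, l₂, o₂, T + U.comp B, h1.trans k1, k2, fun S x s hs hx => ?_⟩
    obtain ⟨s', t, e, ht, hs', hp⟩ := h3 S x s hs hx
    obtain ⟨s'', t', e', ht', hs'', hp'⟩ := k3 _ _ _ hs' (hB _ _ hx)
    refine ⟨s'', t + t', .seq e e', ?_, hs'', fun a ha => ?_⟩
    · rw [Polynomial.eval_add, Polynomial.eval_comp]; exact Nat.add_le_add ht ht'
    · rw [hp' a (ha.trans_le h1), hp a ha]

theorem Holds.of_agree {s s' : State} {l : Data.Idx α → ℕ} {x : α} {o : ℕ} (h : Holds s l x)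
    (ho : 0 < o) (hl : ∀ j, l j < o) (hs : ∀ a < o, s' a = s a) : Holds s' l x :=
  ⟨fun j => by rw [hs _ (hl j)]; exact h.1 j, fun m hm => by rw [hs 0 ho]; exact h.2 m hm⟩

@[fun_prop]
theorem PolyTime.pair {f : α → β} {g : α → γ} (hf : PolyTime f) (hg : PolyTime g) :
    PolyTime fun x => (f x, g x) where
  size := by
    obtain ⟨B, hB⟩ := hf.size
    obtain ⟨C, hC⟩ := hg.size
    refine ⟨B + C, fun S x hx => ?_⟩
    rw [Polynomial.eval_add]
    have h1 := (hB _ _ hx).mono (Nat.le_add_right _ (C.eval S))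
    have h2 := (hC _ _ hx).mono (Nat.le_add_left _ (B.eval S))
    refine ⟨?_, ?_⟩
    · rintro (j | j)
      exacts [h1.1 j, h2.1 j]
    · rintro m (hm | hm)
      exacts [h1.2 m hm, h2.2 m hm]
  prog l o ho hl := by
    obtain ⟨p, l₁, o₁, T, h1, h2, h3⟩ := hf.prog l o ho hl
    obtain ⟨q, l₂, o₂, U, k1, k2, k3⟩ :=
      hg.prog l o₁ (ho.trans_le h1) fun j => (hl j).trans_le h1
    refine ⟨.seq p q, Sum.elim l₁ l₂, o₂, T + U, h1.trans k1, ?_, fun S x s hs hx => ?_⟩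
    · rintro (j | j)
      exacts [(h2 j).trans_le k1, k2 j]
    obtain ⟨s', t, e, ht, hs', hp⟩ := h3 S x s hs hx
    obtain ⟨s'', t', e', ht', hs'', hp'⟩ := k3 _ _ _ (hs.of_agree ho hl hp) hx
    have hs1 := hs'.of_agree (ho.trans_le h1) h2 hp'
    refine ⟨s'', t + t', .seq e e', ?_, ⟨?_, ?_⟩, fun a ha => ?_⟩
    · rw [Polynomial.eval_add]; exact Nat.add_le_add ht ht'
    · rintro (j | j)
      exacts [hs1.1 j, hs''.1 j]
    · rintro m (hm | hm)
      exacts [hs1.2 m hm, hs''.2 m hm]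
    · rw [hp' a (ha.trans_le h1), hp a ha]

@[fun_prop]
theorem PolyTime.fst {f : α → β × γ} (hf : PolyTime f) : PolyTime fun x => (f x).1 :=
  .comp (g := Prod.fst) (.of_words .id Sum.inl (fun _ _ => rfl) fun _ => Set.subset_union_left) hf

@[fun_prop]
theorem PolyTime.snd {f : α → β × γ} (hf : PolyTime f) : PolyTime fun x => (f x).2 :=
  .comp (g := Prod.snd) (.of_words .id Sum.inr (fun _ _ => rfl) fun _ => Set.subset_union_right) hf

@[fun_prop]
theorem PolyTime.app {n : ℕ} (i : Fin n) : PolyTime fun f : Fin n → β => f i :=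
  .of_words .id (fun j => (i, j)) (fun _ _ => rfl)
    fun y => Set.subset_iUnion (fun i => Data.inp (y i)) i

@[fun_prop]
theorem PolyTime.pi {n : ℕ} {f : α → Fin n → β} (hf : ∀ i, PolyTime fun x => f x i) :
    PolyTime f := by
  induction n with
  | zero =>
    exact .of_words .id (fun j => j.1.elim0) (fun _ j => j.1.elim0) fun x => by simp [Data.inp]
  | succ n ih =>
    have h : PolyTime fun y : β × (Fin n → β) => (Fin.cons y.1 y.2 : Fin (n + 1) → β) := by
      refine .of_words .id (fun j => Fin.cases
        (motive := fun _ => Data.Idx β ⊕ (Fin n × Data.Idx β))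
        (Sum.inl j.2) (fun i => Sum.inr (i, j.2)) j.1) ?_ ?_
      · rintro x ⟨i, j⟩
        refine Fin.cases ?_ (fun i => ?_) i <;> rfl
      · intro x
        refine Set.iUnion_subset fun i => ?_
        refine Fin.cases ?_ (fun i => ?_) i
        · exact Set.subset_union_left
        · exact (Set.subset_iUnion (fun i => Data.inp (x.2 i)) i).trans Set.subset_union_right
    have := h.comp (.pair (hf 0) (ih fun i => hf i.succ))
    convert this using 2 with x
    exact (Fin.cons_self_tail _).symm

theorem size_add_le (x y : ℕ) : (x + y).size ≤ x.size + y.size + 1 := by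
  rw [Nat.size_le]
  have hx := Nat.lt_size_self x
  have hy := Nat.lt_size_self y
  have h1 := Nat.pow_le_pow_right (n := 2) two_pos (Nat.le_add_right x.size y.size)
  have h2 := Nat.pow_le_pow_right (n := 2) two_pos (Nat.le_add_left y.size x.size)
  rw [pow_succ]
  omega

theorem size_mul_le (x y : ℕ) : (x * y).size ≤ x.size + y.size := by
  rw [Nat.size_le, pow_add]
  exact Nat.mul_lt_mul'' (Nat.lt_size_self x) (Nat.lt_size_self y)

theorem Op.size_eval_le (o : Op) (x y : ℕ) : (o.eval x y).size ≤ x.size + y.size + 1 := by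
  have hx (z : ℕ) (h : z ≤ x) : z.size ≤ x.size + y.size + 1 := by
    have := Nat.size_le_size h
    omega
  cases o
  · exact size_add_le x y
  · exact hx _ (Nat.sub_le _ _)
  · exact (size_mul_le x y).trans (Nat.le_succ _)
  · exact hx _ (Nat.div_le_self _ _)
  · exact hx _ (Nat.mod_le _ _)

theorem State.write_self (s : State) (a i v : ℕ) : s.write a i v a i = v := by
  simp [State.write]

theorem State.write_of_ne (s : State) {a b : ℕ} (i v : ℕ) (h : b ≠ a) :
    s.write a i v b = s b := by
  simp [State.write, h]

/-- A computed number may be produced by a single assignment whose cost is bounded in terms of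
the numbers in the registers it reads. -/
theorem PolyTime.of_store {f : α → β} {g : β → ℕ} (hf : PolyTime f)
    (e : (Data.Idx β → ℕ) → Expr) (B T : Polynomial ℕ)
    (hB : ∀ S y, SizeLE S y → (g y).size ≤ B.eval S)
    (he : ∀ l S y s, Holds s l y → SizeLE S y →
      (e l).eval s = g y ∧ (e l).cost s ≤ T.eval S) : PolyTime fun x => g (f x) := by
  refine .comp ⟨⟨B, fun S y hy => ⟨fun _ => hB S y hy, fun m hm => hm.elim⟩⟩, ?_⟩ hf
  intro l o ho hl
  refine ⟨.store o (.const 0) (e l), fun _ => o, o + 1, 1 + T + (1 + B), by omega,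
    fun _ => Nat.lt_succ_self o,
    fun S y s hs hy => ⟨_, _, .store s o _ _, ?_, ⟨fun j => ?_, ?_⟩, ?_⟩⟩
  · have h1 := (he l S y s hs hy).2
    have h2 := hB S y hy
    rw [(he l S y s hs hy).1]
    simp only [Polynomial.eval_add, Polynomial.eval_one, Expr.cost, Expr.eval, Nat.size_zero]
    omega
  · rw [(he l S y s hs hy).1]; exact State.write_self _ _ _ _
  · exact fun m hm => hm.elim
  · exact fun a ha => State.write_of_ne _ _ _ (by omega)

theorem PolyTime.const_nat (n : ℕ) : PolyTime fun _ : α => n :=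
  .of_store (g := fun _ => n) .id (fun _ => .const n) (.C n.size) (.C (1 + n.size))
    (fun S y _ => by simp) (fun l S y s _ _ => by simp [Expr.eval, Expr.cost])

@[fun_prop]
theorem PolyTime.const [FlatData β] (y : β) : PolyTime fun _ : α => y := by
  have h : PolyTime fun (_ : α) (i : Fin (Fintype.card (Data.Idx β))) =>
    Data.words y ((Fintype.equivFin _).symm i) := .pi fun i => .const_nat _
  refine .of_words h (fun j => (Fintype.equivFin _ j, ())) (fun x j => ?_) fun x => ?_
  · exact congrArg (Data.words y) (Equiv.symm_apply_apply _ j).symm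
  · simp [FlatData.inp_eq]

theorem PolyTime.op (o : Op) {f g : α → ℕ} (hf : PolyTime f) (hg : PolyTime g) :
    PolyTime fun x => o.eval (f x) (g x) := by
  refine .of_store (g := fun y : ℕ × ℕ => o.eval y.1 y.2) (.pair hf hg)
    (fun l => .bin o (.read (l (.inl ())) (.const 0)) (.read (l (.inr ())) (.const 0)))
    (.X + .X + 1) ((2 + .X) + (2 + .X) + (1 + .X) * (1 + .X)) ?_ ?_
  · intro S y hy
    have h1 : y.1.size ≤ S := hy.1 (.inl ())
    have h2 : y.2.size ≤ S := hy.1 (.inr ())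
    have := o.size_eval_le y.1 y.2
    simp only [Polynomial.eval_add, Polynomial.eval_X, Polynomial.eval_one]
    omega
  · intro l S y s hs hy
    have h1 : y.1.size ≤ S := hy.1 (.inl ())
    have h2 : y.2.size ≤ S := hy.1 (.inr ())
    have k1 : s (l (.inl ())) 0 = y.1 := hs.1 (.inl ())
    have k2 : s (l (.inr ())) 0 = y.2 := hs.1 (.inr ())
    simp only [Expr.eval, Expr.cost, k1, k2, true_and, Polynomial.eval_add, Polynomial.eval_X,
      Polynomial.eval_one, Polynomial.eval_mul, Polynomial.eval_ofNat, Nat.size_zero]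
    have := Nat.mul_le_mul (Nat.add_le_add_left h1 1) (Nat.add_le_add_left h2 1)
    omega

@[fun_prop]
theorem PolyTime.add {f g : α → ℕ} (hf : PolyTime f) (hg : PolyTime g) :
    PolyTime fun x => f x + g x := .op .add hf hg
@[fun_prop]
theorem PolyTime.sub {f g : α → ℕ} (hf : PolyTime f) (hg : PolyTime g) :
    PolyTime fun x => f x - g x := .op .sub hf hg
@[fun_prop]
theorem PolyTime.mul {f g : α → ℕ} (hf : PolyTime f) (hg : PolyTime g) :
    PolyTime fun x => f x * g x := .op .mul hf hg
@[fun_prop]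
theorem PolyTime.div {f g : α → ℕ} (hf : PolyTime f) (hg : PolyTime g) :
    PolyTime fun x => f x / g x := .op .div hf hg
@[fun_prop]
theorem PolyTime.mod {f g : α → ℕ} (hf : PolyTime f) (hg : PolyTime g) :
    PolyTime fun x => f x % g x := .op .mod hf hg

/-- The word at position `i` of the input tape. As a constant of its own, it keeps the access to the
tape apart from the projections of tuples. -/
def readInput (w : ℕ → ℕ) (i : ℕ) : ℕ := w i

@[fun_prop]
theorem PolyTime.readInput {w : α → ℕ → ℕ} {i : α → ℕ} (hw : PolyTime w) (hi : PolyTime i) :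
    PolyTime fun x => readInput (w x) (i x) := by
  refine .of_store (g := fun y : (ℕ → ℕ) × ℕ => y.1 y.2) (.pair hw hi)
    (fun l => .read 0 (.read (l (.inr ())) (.const 0))) .X ((2 + .X) + (1 + .X + .X)) ?_ ?_
  · intro S y hy
    rw [Polynomial.eval_X]
    exact hy.2 y.1 (.inl rfl) y.2
  · intro l S y s hs hy
    have h1 : (y.1 y.2).size ≤ S := hy.2 y.1 (.inl rfl) y.2
    have h2 : y.2.size ≤ S := hy.1 (.inr ())
    have k2 : s (l (.inr ())) 0 = y.2 := hs.1 (.inr ())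
    have k1 : s 0 = y.1 := hs.2 y.1 (.inl rfl)
    simp only [Expr.eval, Expr.cost, k1, k2, true_and, Polynomial.eval_add, Polynomial.eval_X,
      Polynomial.eval_one, Polynomial.eval_ofNat, Nat.size_zero]
    omega

@[fun_prop]
theorem PolyTime.sum {n : ℕ} {f : α → Fin n → ℕ} (hf : ∀ i, PolyTime fun x => f x i) :
    PolyTime fun x => ∑ i, f x i := by
  induction n with
  | zero => simpa using PolyTime.const_nat 0
  | succ n ih =>
    simp only [Fin.sum_univ_succ]
    exact (hf 0).add (ih fun i => hf i.succ)

/-- Copying registers to fresh registers. -/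
theorem exists_copy {J : Type} (L : List J) (l d : J → ℕ) (hd : Function.Injective d)
    (hne : ∀ i j, l i ≠ d j) : ∃ (p : Prog) (T : Polynomial ℕ), ∀ (S : ℕ) (s : State),
      (∀ j, (s (l j) 0).size ≤ S) → ∃ s' t, Exec p s s' t ∧ t ≤ T.eval S ∧
        (∀ j ∈ L, s' (d j) 0 = s (l j) 0) ∧ ∀ a, (∀ j ∈ L, a ≠ d j) → s' a = s a := by
  induction L with
  | nil => exact ⟨.skip, 1, fun S s _ => ⟨s, 1, .skip s, by simp, by simp, fun _ _ => rfl⟩⟩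
  | cons i L ih =>
    obtain ⟨p, T, h⟩ := ih
    refine ⟨.seq p (.store (d i) (.const 0) (.read (l i) (.const 0))),
      T + (4 + .X + .X), fun S s hs => ?_⟩
    obtain ⟨s', t, e, ht, h1, h2⟩ := h S s hs
    have hl : s' (l i) = s (l i) := h2 _ fun j _ => hne i j
    refine ⟨_, _, .seq e (.store _ _ _ _), ?_, ?_, ?_⟩
    · have := hs i
      simp only [Expr.eval, Expr.cost, Polynomial.eval_add, Polynomial.eval_X,
        Polynomial.eval_ofNat, Nat.size_zero, hl]
      omega
    · intro j hj
      by_cases hij : j = i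
      · subst hij
        simp only [Expr.eval, State.write_self, hl]
      · rw [State.write_of_ne _ _ _ fun h => hij (hd h)]
        exact h1 j ((List.mem_cons.1 hj).resolve_left hij)
    · intro a ha
      rw [State.write_of_ne _ _ _ (ha i (by simp))]
      exact h2 a fun j hj => ha j (by simp [hj])

/-- Moving a value to given fresh registers `d`. -/
theorem exists_move (l d : Data.Idx α → ℕ) (hd : Function.Injective d)
    (hne : ∀ i j, l i ≠ d j) (h0 : ∀ j, 0 < d j) : ∃ (p : Prog) (T : Polynomial ℕ),
      ∀ (S : ℕ) (x : α) (s : State), Holds s l x → SizeLE S x →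
        ∃ s' t, Exec p s s' t ∧ t ≤ T.eval S ∧ Holds s' d x ∧ ∀ a, (∀ j, a ≠ d j) → s' a = s a := by
  obtain ⟨p, T, h⟩ := exists_copy (Finset.univ (α := Data.Idx α)).toList l d hd hne
  refine ⟨p, T, fun S x s hs hx => ?_⟩
  obtain ⟨s', t, e, ht, h1, h2⟩ := h S s fun j => by rw [hs.1]; exact hx.1 j
  have hp : ∀ a, (∀ j, a ≠ d j) → s' a = s a := fun a ha => h2 a fun j _ => ha j
  refine ⟨s', t, e, ht, ⟨fun j => ?_, fun m hm => ?_⟩, hp⟩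
  · rw [h1 j (by simp), hs.1]
  · rw [hp 0 fun j => (h0 j).ne]; exact hs.2 m hm

/-- Consecutive registers from `o` on. -/
noncomputable def block (α : Type) [Data α] (o : ℕ) (j : Data.Idx α) : ℕ :=
  o + (Fintype.equivFin (Data.Idx α) j : ℕ)

theorem block_injective (o : ℕ) : Function.Injective (block α o) := fun i j h => by
  simp only [block, Nat.add_left_cancel_iff] at h
  exact (Fintype.equivFin _).injective (Fin.ext h)

theorem le_block (o : ℕ) (j : Data.Idx α) : o ≤ block α o j := Nat.le_add_right _ _

theorem block_lt (o : ℕ) (j : Data.Idx α) : block α o j < o + Fintype.card (Data.Idx α) :=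
  Nat.add_lt_add_left (Fin.is_lt _) o

/-- `ifz c x y` is `x` if `c = 0`, and `y` otherwise. The machine tests words, so
conditions are encoded as numbers. -/
def ifz {β : Type} (c : ℕ) (x y : β) : β := if c = 0 then x else y

@[fun_prop]
theorem PolyTime.ifz {c : α → ℕ} {f g : α → β} (hc : PolyTime c) (hf : PolyTime f)
    (hg : PolyTime g) : PolyTime fun x => ifz (c x) (f x) (g x) where
  size := by
    obtain ⟨B, hB⟩ := hf.size
    obtain ⟨C, hC⟩ := hg.size
    refine ⟨B + C, fun S x hx => ?_⟩
    rw [Polynomial.eval_add, RAM.ifz]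
    split
    · exact (hB _ _ hx).mono (Nat.le_add_right _ _)
    · exact (hC _ _ hx).mono (Nat.le_add_left _ _)
  prog l o ho hl := by
    obtain ⟨A, hA⟩ := hc.size
    obtain ⟨B, hB⟩ := hf.size
    obtain ⟨C, hC⟩ := hg.size
    obtain ⟨pc, lc, o₁, Tc, c1, c2, c3⟩ := hc.prog l o ho hl
    have hl₂ : ∀ j, l j < o₁ := fun j => (hl j).trans_le c1
    obtain ⟨pf, lf, o₃, Tf, f1, f2, f3⟩ := hf.prog l o₁ (by omega) hl₂
    obtain ⟨pg, lg, o₄, Tg, g1, g2, g3⟩ := hg.prog l o₁ (by omega) hl₂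
    -- The results of both branches are moved to a common place above all other registers.
    set o₅ := max o₃ o₄ with ho₅
    have h5 (j) := le_block (α := β) o₅ j
    have h05 : ∀ j, 0 < block β o₅ j := fun j => by have := h5 j; omega
    obtain ⟨mf, Uf, hmf⟩ := exists_move lf (block β o₅) (block_injective _)
      (fun i j h => by have := f2 i; have := h5 j; omega) h05
    obtain ⟨mg, Ug, hmg⟩ := exists_move lg (block β o₅) (block_injective _)
      (fun i j h => by have := g2 i; have := h5 j; omega) h05
    refine ⟨.seq pc (.ite (.read (lc ()) (.const 0)) (.seq pg mg) (.seq pf mf)), block β o₅,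
      o₅ + Fintype.card (Data.Idx β),
      Tc + (3 + A) + (Tf + Uf.comp B) + (Tg + Ug.comp C), by omega, block_lt _, ?_⟩
    intro S x s hs hx
    obtain ⟨s₁, t₁, e₁, ht₁, hs₁, hp₁⟩ := c3 S x s hs hx
    have hcx : s₁ (lc ()) 0 = c x := hs₁.1 ()
    have hcs : (c x).size ≤ A.eval S := (hA S x hx).1 ()
    have hx₁ : Holds s₁ l x := hs.of_agree ho hl hp₁
    have hcost : (Expr.read (lc ()) (.const 0)).cost s₁ + 1 ≤ 3 + A.eval S := by
      simp only [Expr.cost, Expr.eval, Nat.size_zero, hcx]; omega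
    simp only [Polynomial.eval_add, Polynomial.eval_comp, Polynomial.eval_ofNat, RAM.ifz]
    split
    · rename_i h
      obtain ⟨s₂, t₂, e₂, ht₂, hs₂, hp₂⟩ := f3 S x s₁ hx₁ hx
      obtain ⟨s₃, t₃, e₃, ht₃, hs₃, hp₃⟩ := hmf _ _ _ hs₂ (hB _ _ hx)
      refine ⟨_, _, .seq e₁ (.ite_false (by simp [Expr.eval, hcx, h]) (.seq e₂ e₃)), by omega, hs₃,
        fun a ha => ?_⟩
      rw [hp₃ a fun j => by have := h5 j; omega, hp₂ a (by omega), hp₁ a ha]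
    · rename_i h
      obtain ⟨s₂, t₂, e₂, ht₂, hs₂, hp₂⟩ := g3 S x s₁ hx₁ hx
      obtain ⟨s₃, t₃, e₃, ht₃, hs₃, hp₃⟩ := hmg _ _ _ hs₂ (hC _ _ hx)
      refine ⟨_, _, .seq e₁ (.ite_true (by simp [Expr.eval, hcx, h]) (.seq e₂ e₃)), by omega, hs₃,
        fun a ha => ?_⟩
      rw [hp₃ a fun j => by have := h5 j; omega, hp₂ a (by omega), hp₁ a ha]

theorem size_eq_size_half_succ {v : ℕ} (hv : v ≠ 0) : v.size = (v / 2).size + 1 := by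
  apply le_antisymm
  · rw [Nat.size_le, pow_succ]
    have := Nat.lt_size_self (v / 2)
    omega
  · rw [Nat.succ_le_iff, Nat.lt_size]
    by_cases h : v / 2 = 0
    · rw [h, Nat.size_zero, pow_zero]; omega
    · have : 2 ^ ((v / 2).size - 1) ≤ v / 2 :=
        Nat.lt_size.1 (Nat.sub_lt (Nat.size_pos.2 (Nat.pos_of_ne_zero h)) one_pos)
      have hs := Nat.size_pos.2 (Nat.pos_of_ne_zero h)
      obtain ⟨k, hk⟩ := Nat.exists_eq_succ_of_ne_zero hs.ne'
      rw [hk, Nat.succ_eq_add_one, pow_succ]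
      rw [hk, Nat.succ_eq_add_one, Nat.add_sub_cancel] at this
      omega

/-- A loop whose counter `κ` is halved in every round runs as often as the counter has bits. -/
theorem exec_halving_loop {κ o : ℕ} {p : Prog} {d : Data.Idx β → ℕ} {F : β → β}
    {I : β → Prop} {C S : ℕ} {P : State → Prop} (hI : ∀ y, I y → I (F y))
    (hp : ∀ y s, I y → Holds s d y → P s → (s κ 0).size ≤ S →
      ∃ s' t, Exec p s s' t ∧ t ≤ C ∧ Holds s' d (F y) ∧ P s' ∧ s' κ 0 = s κ 0 / 2 ∧
        ∀ a < o, s' a = s a)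
    (v : ℕ) (hv : v.size ≤ S) (y : β) (s : State) (hy : I y) (hs : Holds s d y) (hP : P s)
    (hκ : s κ 0 = v) :
    ∃ s' t, Exec (.loop (.read κ (.const 0)) p) s s' t ∧ t ≤ v.size * (C + S + 3) + (S + 3) ∧
      Holds s' d (F^[v.size] y) ∧ ∀ a < o, s' a = s a := by
  have hcost : (Expr.read κ (.const 0)).cost s + 1 ≤ S + 3 := by
    simp only [Expr.cost, Expr.eval, Nat.size_zero, hκ]; omega
  by_cases h : v = 0
  · subst h
    refine ⟨s, _, .loop_false (by simp [Expr.eval, hκ]), ?_, ?_, fun _ _ => rfl⟩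
    · omega
    · simpa using hs
  · have hv' := size_eq_size_half_succ h
    obtain ⟨s₁, t₁, e₁, ht₁, hs₁, hP₁, hκ₁, hp₁⟩ := hp y s hy hs hP (by rw [hκ]; exact hv)
    obtain ⟨s₂, t₂, e₂, ht₂, hs₂, hp₂⟩ := exec_halving_loop hI hp (v / 2) (by omega) (F y) s₁
      (hI y hy) hs₁ hP₁ (by rw [hκ₁, hκ])
    refine ⟨s₂, _, .loop_true (by simp [Expr.eval, hκ, h]) e₁ e₂, ?_, ?_, fun a ha => ?_⟩
    · rw [hv', Nat.succ_mul]; omega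
    · rw [hv', Function.iterate_succ_apply]; exact hs₂
    · rw [hp₂ a ha, hp₁ a ha]
termination_by v
decreasing_by omega

/-- Bounded iteration: polynomially many rounds, provided that the words of all intermediate
results are of polynomial length. -/
theorem PolyTime.iterate {n : α → ℕ} {x₀ : α → β} {F : α → β → β} (hn : PolyTime n)
    (h₀ : PolyTime x₀) (hF : PolyTime fun q : α × β => F q.1 q.2)
    (hB : ∃ B : Polynomial ℕ, ∀ S x, SizeLE S x → ∀ k, SizeLE (B.eval S) ((F x)^[k] (x₀ x))) :
    PolyTime fun x => (F x)^[(n x).size] (x₀ x) where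
  size := by
    obtain ⟨B, hB⟩ := hB
    exact ⟨B, fun S x hx => hB S x hx _⟩
  prog l o ho hl := by
    obtain ⟨B, hB⟩ := hB
    obtain ⟨A, hA⟩ := hn.size
    obtain ⟨pn, ln, o₁, Tn, n1, n2, n3⟩ := hn.prog l o ho hl
    obtain ⟨p0, l0, o₂, T0, z1, z2, z3⟩ := h₀.prog l o₁ (by omega) fun j => (hl j).trans_le n1
    -- The counter is register `o₂`, the state of the iteration stands in the block `d` after it.
    set d := block β (o₂ + 1) with hd
    have hd1 (j) : o₂ + 1 ≤ d j := le_block _ j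
    set o₃ := o₂ + 1 + Fintype.card (Data.Idx β) with ho₃
    have hd2 (j) : d j < o₃ := block_lt _ j
    obtain ⟨m0, U0, hm0⟩ := exists_move l0 d (block_injective _)
      (fun i j h => by have := z2 i; have := hd1 j; omega) (fun j => by have := hd1 j; omega)
    have hld : ∀ j, Sum.elim l d j < o₃ := by
      rintro (j | j)
      · exact (hl j).trans_le (by omega)
      · exact hd2 j
    obtain ⟨pb, lb, o₄, Tb, b1, b2, b3⟩ := hF.prog (Sum.elim l d) o₃ (by omega) hld
    -- The new state may partly stand in the registers `d` itself, so it is moved there via `e`.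
    set e := block β o₄ with he
    have he1 (j) : o₄ ≤ e j := le_block _ j
    have he2 (j) : e j < o₄ + Fintype.card (Data.Idx β) := block_lt _ j
    obtain ⟨m1, U1, hm1⟩ := exists_move lb e (block_injective _)
      (fun i j h => by have := b2 i; have := he1 j; omega) (fun j => by have := he1 j; omega)
    obtain ⟨m2, U2, hm2⟩ := exists_move e d (block_injective _)
      (fun i j h => by have := he1 i; have := hd2 j; omega) (fun j => by have := hd1 j; omega)
    set half : Prog := .store o₂ (.const 0) (.bin .div (.read o₂ (.const 0)) (.const 2)) with hhalf
    -- Time of one round of the loop.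
    set R : Polynomial ℕ := Tb.comp (.X + B) + U1.comp B + U2.comp B +
      (1 + (2 + A + 3 + (1 + A) * 3) + (2 + A)) with hR
    refine ⟨.seq (.seq pn p0) (.seq (.seq (.store o₂ (.const 0) (.read (ln ()) (.const 0))) m0)
      (.loop (.read o₂ (.const 0)) (.seq (.seq pb m1) (.seq m2 half)))), d, o₃,
      (Tn + T0) + ((4 + A + A) + U0.comp B) + (A * (R + A + 3) + (A + 3)), by omega, hd2, ?_⟩
    intro S x s hs hx
    obtain ⟨s₁, t₁, e₁, ht₁, hs₁, hp₁⟩ := n3 S x s hs hx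
    have hx₁ : Holds s₁ l x := hs.of_agree ho hl hp₁
    obtain ⟨s₂, t₂, e₂, ht₂, hs₂, hp₂⟩ := z3 S x s₁ hx₁ hx
    have hx₂ : Holds s₂ l x := hx₁.of_agree (by omega) (fun j => (hl j).trans_le n1) hp₂
    have hn₂ : s₂ (ln ()) 0 = n x := by rw [hp₂ _ (n2 ())]; exact hs₁.1 ()
    have hnA : (n x).size ≤ A.eval S := (hA S x hx).1 ()
    set s₃ := s₂.write o₂ 0 (n x) with hs₃
    have hp₃ : ∀ a < o₂, s₃ a = s₂ a := fun a ha => State.write_of_ne _ _ _ ha.ne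
    have e₃ := Exec.store s₂ o₂ (.const 0) (.read (ln ()) (.const 0))
    simp only [Expr.eval, hn₂, ← hs₃] at e₃
    have hy₃ : Holds s₃ l0 (x₀ x) := hs₂.of_agree (by omega) z2 hp₃
    obtain ⟨s₄, t₄, e₄, ht₄, hs₄, hp₄⟩ := hm0 _ _ _ hy₃ (hB S x hx 0)
    have hp₄' : ∀ a < o₂ + 1, s₄ a = s₃ a := fun a ha => hp₄ a fun j => by
      have := hd1 j; omega
    have hx₄ : Holds s₄ l x := (hx₂.of_agree (by omega) (fun j => (hl j).trans_le (by omega))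
      hp₃).of_agree (by omega) (fun j => (hl j).trans_le (by omega)) fun a ha => hp₄' a ha
    have hκ₄ : s₄ o₂ 0 = n x := by
      rw [hp₄' _ (Nat.lt_succ_self _), hs₃]; exact State.write_self _ _ _ _
    have hround : ∀ y s, (∃ k, y = (F x)^[k] (x₀ x)) → Holds s d y → Holds s l x →
        (s o₂ 0).size ≤ A.eval S → ∃ s' t, Exec (.seq (.seq pb m1) (.seq m2 half)) s s' t ∧
          t ≤ R.eval S ∧ Holds s' d (F x y) ∧ Holds s' l x ∧ s' o₂ 0 = s o₂ 0 / 2 ∧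
          ∀ a < o₂, s' a = s a := by
      rintro y s ⟨k, hk⟩ hsd hsl hκ
      have hyB : SizeLE (B.eval S) y := hk ▸ hB S x hx k
      have hFyB : SizeLE (B.eval S) (F x y) := by
        have := hB S x hx (k + 1)
        rwa [Function.iterate_succ_apply', ← hk] at this
      have hxy : Holds s (Sum.elim l d : Data.Idx (α × β) → ℕ) (x, y) := by
        refine ⟨?_, ?_⟩
        · rintro (j | j)
          exacts [hsl.1 j, hsd.1 j]
        · rintro m (hm | hm)
          exacts [hsl.2 m hm, hsd.2 m hm]
      have hxyB : SizeLE (S + B.eval S) (x, y) := by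
        have h1 := hx.mono (Nat.le_add_right S (B.eval S))
        have h2 := hyB.mono (Nat.le_add_left _ S)
        refine ⟨?_, ?_⟩
        · rintro (j | j)
          exacts [h1.1 j, h2.1 j]
        · rintro m (hm | hm)
          exacts [h1.2 m hm, h2.2 m hm]
      obtain ⟨u₁, r₁, c₁, hr₁, hu₁, hq₁⟩ := b3 _ _ _ hxy hxyB
      obtain ⟨u₂, r₂, c₂, hr₂, hu₂, hq₂⟩ := hm1 _ _ _ hu₁ hFyB
      obtain ⟨u₃, r₃, c₃, hr₃, hu₃, hq₃⟩ := hm2 _ _ _ hu₂ hFyB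
      have hq : ∀ a < o₂ + 1, u₃ a = s a := fun a ha => by
        rw [hq₃ a fun j => by have := hd1 j; omega, hq₂ a fun j => by have := he1 j; omega,
          hq₁ a (by omega)]
      have hκ₃ : u₃ o₂ 0 = s o₂ 0 := by rw [hq _ (Nat.lt_succ_self _)]
      have hlt (j) : l j < o₂ := (hl j).trans_le (by omega)
      set u₄ := u₃.write o₂ 0 (s o₂ 0 / 2) with hu₄
      have hne : ∀ a, a ≠ o₂ → u₄ a = u₃ a := fun a ha => State.write_of_ne _ _ _ ha
      have c₄ := Exec.store u₃ o₂ (.const 0) (.bin .div (.read o₂ (.const 0)) (.const 2))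
      simp only [Expr.eval, Op.eval, hκ₃, ← hu₄] at c₄
      refine ⟨u₄, _, .seq (.seq c₁ c₂) (.seq c₃ c₄), ?_, ⟨fun j => ?_, fun m hm => ?_⟩, ?_,
        State.write_self _ _ _ _, fun a ha => ?_⟩
      · have h2 : (s o₂ 0 / 2).size ≤ A.eval S :=
          (Nat.size_le_size (Nat.div_le_self _ _)).trans hκ
        have h3 : Nat.size 2 = 2 := by decide +kernel
        have h4 := Nat.mul_le_mul_right 3 (Nat.add_le_add_left hκ 1)
        simp only [hR, Polynomial.eval_add, Polynomial.eval_comp, Polynomial.eval_mul,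
          Polynomial.eval_X, Polynomial.eval_one, Polynomial.eval_ofNat, Expr.cost, Expr.eval,
          hκ₃, Nat.size_zero, h3]
        omega
      · rw [hne _ (by have := hd1 j; omega)]; exact hu₃.1 j
      · rw [hne _ (by omega)]; exact hu₃.2 m hm
      · refine ⟨fun j => ?_, fun m hm => ?_⟩
        · rw [hne _ (hlt j).ne, hq _ (by have := hlt j; omega)]; exact hsl.1 j
        · rw [hne _ (by omega), hq _ (by omega)]; exact hsl.2 m hm
      · rw [hne _ ha.ne, hq _ (by omega)]
    obtain ⟨s₅, t₅, e₅, ht₅, hs₅, hp₅⟩ := exec_halving_loop (o := o₂)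
      (I := fun y => ∃ k, y = (F x)^[k] (x₀ x)) (P := fun s => Holds s l x)
      (by rintro y ⟨k, rfl⟩; exact ⟨k + 1, (Function.iterate_succ_apply' _ _ _).symm⟩) hround
      (n x) hnA (x₀ x) s₄ ⟨0, rfl⟩ hs₄ hx₄ hκ₄
    refine ⟨s₅, _, .seq (.seq e₁ e₂) (.seq (.seq e₃ e₄) e₅), ?_, hs₅, fun a ha => ?_⟩
    · have h1 := Nat.mul_le_mul_right (R.eval S + A.eval S + 3) hnA
      simp only [Polynomial.eval_add, Polynomial.eval_comp, Polynomial.eval_mul,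
        Polynomial.eval_ofNat, Expr.cost, Expr.eval, Nat.size_zero, hn₂]
      omega
    · rw [hp₅ a (by omega), hp₄' a (by omega), hp₃ a (by omega), hp₂ a (by omega), hp₁ a ha]

/-- Bounded iteration on plain tuples, where a computable bound `W` on the words is an invariant. -/
theorem PolyTime.iterate_of_le [FlatData β] {n W : α → ℕ} {x₀ : α → β} {F : α → β → β}
    (hn : PolyTime n) (hW : PolyTime W) (h₀ : PolyTime x₀)
    (hF : PolyTime fun q : α × β => F q.1 q.2) (hb₀ : ∀ x, WordsLE (W x) (x₀ x))
    (hb : ∀ x y, WordsLE (W x) y → WordsLE (W x) (F x y)) :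
    PolyTime fun x => (F x)^[(n x).size] (x₀ x) := by
  refine .iterate hn h₀ hF ?_
  obtain ⟨B, hB⟩ := hW.size
  refine ⟨B, fun S x hx k => WordsLE.sizeLE (W := W x) ?_ ((hB S x hx).1 ())⟩
  induction k with
  | zero => exact hb₀ x
  | succ k ih => rw [Function.iterate_succ_apply']; exact hb x _ ih

theorem size_getD_le_bitLength (w : List ℕ) (i : ℕ) : (w.getD i 0).size ≤ bitLength w := by
  induction w generalizing i with
  | nil => simp
  | cons x w ih =>
    simp only [bitLength, List.map_cons, List.sum_cons]
    cases i with
    | zero => simp only [List.getD_cons_zero]; omega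
    | succ i => have := ih i; simp only [bitLength] at this; simp only [List.getD_cons_succ]; omega

/-- Writing the contents of registers to consecutive cells of the output array. -/
theorem exists_write_output {n : ℕ} (L : List (Fin n)) (d : Fin n → ℕ) (hd : ∀ j, d j ≠ 2) :
    ∃ (p : Prog) (T : Polynomial ℕ), ∀ (S : ℕ) (s : State), (∀ j, (s (d j) 0).size ≤ S) →
      ∃ s' t, Exec p s s' t ∧ t ≤ T.eval S ∧ (∀ j ∈ L, s' 2 j = s (d j) 0) ∧
        ∀ a ≠ 2, s' a = s a := by
  induction L with
  | nil => exact ⟨.skip, 1, fun S s _ => ⟨s, 1, .skip s, by simp, by simp, fun _ _ => rfl⟩⟩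
  | cons i L ih =>
    obtain ⟨p, T, h⟩ := ih
    refine ⟨.seq p (.store 2 (.const i) (.read (d i) (.const 0))),
      T + (.C (4 + 2 * (i : ℕ).size) + .X + .X), fun S s hs => ?_⟩
    obtain ⟨s', t, e, ht, h1, h2⟩ := h S s hs
    have hi : s' (d i) = s (d i) := h2 _ (hd i)
    refine ⟨_, _, .seq e (.store _ _ _ _), ?_, ?_, ?_⟩
    · have := hs i
      simp only [Expr.eval, Expr.cost, Polynomial.eval_add, Polynomial.eval_X,
        Polynomial.eval_C, Nat.size_zero, hi]
      omega
    · intro j hj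
      by_cases hij : j = i
      · subst hij
        simp only [Expr.eval, State.write_self, hi]
      · have hne : (j : ℕ) ≠ i := fun h => hij (Fin.ext h)
        simp only [State.write, Function.update_self, Expr.eval, Function.update_of_ne hne]
        exact h1 j ((List.mem_cons.1 hj).resolve_left hij)
    · intro a ha
      rw [State.write_of_ne _ _ _ ha, h2 a ha]

/-- A polynomial-time function of the input tape yields a program in the format for input and
output of words. -/
theorem PolyTime.exists_prog {n : ℕ} {f : (ℕ → ℕ) → Fin n → ℕ} (hf : PolyTime f) :
    ∃ (P : Prog) (T : Polynomial ℕ), ∀ w : List ℕ, ∃ s t, Exec P (inputState w) s t ∧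
      t ≤ T.eval (bitLength w) ∧ s.output = List.ofFn (f fun i => w.getD i 0) := by
  obtain ⟨B, hB⟩ := hf.size
  obtain ⟨p, l, o, T, h1, h2, h3⟩ := hf.prog Empty.elim 4 (by omega) fun j => j.elim
  have hd (j) := le_block (α := Fin n → ℕ) o j
  obtain ⟨m, U, hm⟩ := exists_move (α := Fin n → ℕ) l (block (Fin n → ℕ) o) (block_injective _)
    (fun i j h => by have := h2 i; have := hd j; omega) (fun j => by have := hd j; omega)
  obtain ⟨q, V, hq⟩ := exists_write_output (List.finRange n) (fun j => block (Fin n → ℕ) o (j, ()))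
    (fun j => by have := hd (j, ()); omega)
  refine ⟨.seq (.seq p m) (.seq q (.store 3 (.const 0) (.const n))),
    (T + U.comp B) + (V.comp B + .C (3 + 2 * n.size)), fun w => ?_⟩
  set x : ℕ → ℕ := fun i => w.getD i 0 with hx
  have hxS : SizeLE (bitLength w) x := ⟨fun j => j.elim, by
    rintro _ rfl i
    exact size_getD_le_bitLength w i⟩
  have hin : Holds (inputState w) Empty.elim x := ⟨fun j => j.elim, by
    rintro _ rfl
    rfl⟩
  obtain ⟨s₁, t₁, e₁, ht₁, hs₁, -⟩ := h3 _ _ _ hin hxS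
  obtain ⟨s₂, t₂, e₂, ht₂, hs₂, -⟩ := hm _ _ _ hs₁ (hB _ _ hxS)
  obtain ⟨s₃, t₃, e₃, ht₃, hs₃, -⟩ := hq (B.eval (bitLength w)) s₂
    fun j => by rw [hs₂.1]; exact (hB _ _ hxS).1 _
  refine ⟨_, _, .seq (.seq e₁ e₂) (.seq e₃ (.store _ _ _ _)), ?_, ?_⟩
  · simp only [Polynomial.eval_add, Polynomial.eval_comp, Polynomial.eval_C, Expr.cost, Expr.eval,
      Nat.size_zero]
    omega
  · simp only [State.output, Expr.eval, State.write_self]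
    rw [State.write_of_ne _ _ _ (by omega), List.ofFn_eq_map, ← List.map_coe_finRange_eq_range,
      List.map_map]
    exact List.map_congr_left fun j hj => (hs₃ j hj).trans (hs₂.1 (j, ()))

@[simp]
theorem wordsLE_nat {W x : ℕ} : WordsLE W x ↔ x ≤ W := ⟨fun h => h (), fun h _ => h⟩

@[simp]
theorem wordsLE_pair {W : ℕ} {x : α} {y : β} : WordsLE W (x, y) ↔ WordsLE W x ∧ WordsLE W y :=
  ⟨fun h => ⟨fun j => h (.inl j), fun j => h (.inr j)⟩, fun h j => j.casesOn h.1 h.2⟩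

@[simp]
theorem wordsLE_pi {W n : ℕ} {x : Fin n → α} : WordsLE W x ↔ ∀ i, WordsLE W (x i) :=
  ⟨fun h i j => h (i, j), fun h j => h j.1 j.2⟩

theorem WordsLE.ifz {W c : ℕ} {x y : α} (hx : WordsLE W x) (hy : WordsLE W y) :
    WordsLE W (ifz c x y) := by
  unfold RAM.ifz; split <;> assumption

/-! ### Arithmetic modulo `M` -/

/-- The residue of `x` modulo `M`, with modulus `1` in place of the junk modulus `0`, so that the
result is always at most `M`. -/
def md (x M : ℕ) : ℕ := x % (M - 1 + 1)

theorem md_le (x M : ℕ) : md x M ≤ M := by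
  have := Nat.mod_lt x (Nat.succ_pos (M - 1))
  simp only [md, Nat.succ_eq_add_one] at *
  omega

@[fun_prop]
theorem PolyTime.md {x M : α → ℕ} (hx : PolyTime x) (hM : PolyTime M) :
    PolyTime fun a => md (x a) (M a) := by
  unfold RAM.md; fun_prop

/-- A step of repeated squaring: the state `(a, b, e)` stands for `a * b ^ e`. -/
def powStep (M : ℕ) (y : ℕ × ℕ × ℕ) : ℕ × ℕ × ℕ :=
  (ifz (y.2.2 % 2) y.1 (md (y.1 * y.2.1) M), md (y.2.1 * y.2.1) M, y.2.2 / 2)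

/-- `b ^ e` modulo `M` by repeated squaring. -/
def powMod (M b e : ℕ) : ℕ := ((powStep M)^[e.size] (md 1 M, md b M, e)).1

theorem wordsLE_powStep {W M : ℕ} (hM : M ≤ W) {y : ℕ × ℕ × ℕ} (hy : WordsLE W y) :
    WordsLE W (powStep M y) := by
  obtain ⟨a, b, c⟩ := y
  simp only [wordsLE_pair, wordsLE_nat] at hy
  simp only [powStep, wordsLE_pair]
  exact ⟨.ifz (wordsLE_nat.2 hy.1) (wordsLE_nat.2 ((md_le _ _).trans hM)),
    wordsLE_nat.2 ((md_le _ _).trans hM), wordsLE_nat.2 ((Nat.div_le_self _ _).trans hy.2.2)⟩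

@[fun_prop]
theorem PolyTime.powMod {M b e : α → ℕ} (hM : PolyTime M) (hb : PolyTime b) (he : PolyTime e) :
    PolyTime fun a => powMod (M a) (b a) (e a) := by
  unfold RAM.powMod
  refine .fst (.iterate_of_le (W := fun a => M a + e a) (F := fun a => powStep (M a)) he
    (by fun_prop) (by fun_prop) (by unfold powStep; fun_prop) (fun x => ?_) fun x y hy =>
      wordsLE_powStep (Nat.le_add_right _ _) hy)
  simp only [wordsLE_pair, wordsLE_nat]
  exact ⟨(md_le _ _).trans (Nat.le_add_right _ _), (md_le _ _).trans (Nat.le_add_right _ _),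
    Nat.le_add_left _ _⟩

/-! ### Selective square roots and sums of two squares modulo `p` -/

/-- Zero if and only if `x ^ E = 1` modulo `p`. -/
def powSubOne (p x E : ℕ) : ℕ := md (powMod p x E + (p - 1)) p

@[fun_prop]
theorem PolyTime.powSubOne {p x E : α → ℕ} (hp : PolyTime p) (hx : PolyTime x)
    (hE : PolyTime E) : PolyTime fun a => powSubOne (p a) (x a) (E a) := by
  unfold RAM.powSubOne; fun_prop

/-- `E / 2` if `E` is even and `x ^ (E / 2) = y ^ (E / 2) = 1` modulo `p`, and `E` otherwise. -/
def halveStep (p x y E : ℕ) : ℕ :=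
  ifz (E % 2 + powSubOne p x (E / 2) + powSubOne p y (E / 2)) (E / 2) E

/-- The exponent `p - 1`, halved as long as it is even and half of it still kills `x` and `y`. -/
def commonExponent (p x y : ℕ) : ℕ := (halveStep p x y)^[p.size] (p - 1)

@[fun_prop]
theorem PolyTime.commonExponent {p x y : α → ℕ} (hp : PolyTime p) (hx : PolyTime x)
    (hy : PolyTime y) : PolyTime fun a => commonExponent (p a) (x a) (y a) := by
  unfold RAM.commonExponent
  refine .iterate_of_le (W := p) (F := fun a => halveStep (p a) (x a) (y a)) hp hp
    (by fun_prop) (by unfold halveStep; fun_prop) (fun a => ?_) fun a E hE => ?_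
  · exact wordsLE_nat.2 (Nat.sub_le _ _)
  · exact .ifz (wordsLE_nat.2 ((Nat.div_le_self _ _).trans (wordsLE_nat.1 hE))) hE

/-- A step of the Tonelli–Shanks algorithm for the square root of `z`. The state `(E, r, g)`
satisfies `(z * r ^ 2) ^ E = 1`, and `g ^ E = -1` if `E` is even; the step halves an even `E`. -/
def rootStep (p z : ℕ) (y : ℕ × ℕ × ℕ) : ℕ × ℕ × ℕ :=
  ifz (y.1 % 2) (y.1 / 2, ifz (powSubOne p (z * y.2.1 * y.2.1) (y.1 / 2)) y.2.1
    (md (y.2.1 * y.2.2) p), md (y.2.2 * y.2.2) p) y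

/-- A square root of `z` modulo `p`, if `z ^ E = 1` and, in case `E` is even, `g ^ E = -1`. Once `E`
is odd, `z r ^ 2` is the square of `(z r ^ 2) ^ ((E + 1) / 2)`. -/
def rootMod (p z g E : ℕ) : ℕ :=
  let y := (rootStep p z)^[p.size] (E, 1, md g p)
  md (powMod p (z * y.2.1 * y.2.1) ((y.1 + 1) / 2) * powMod p y.2.1 (p - 2)) p

@[fun_prop]
theorem PolyTime.rootMod {p z g E : α → ℕ} (hp : PolyTime p) (hz : PolyTime z)
    (hg : PolyTime g) (hE : PolyTime E) :
    PolyTime fun a => rootMod (p a) (z a) (g a) (E a) := by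
  have h : PolyTime fun a => (rootStep (p a) (z a))^[(p a).size] (E a, 1, RAM.md (g a) (p a)) := by
    refine .iterate_of_le (W := fun a => p a + E a + 1) (F := fun a => rootStep (p a) (z a)) hp
      (by fun_prop) (by fun_prop) (by unfold rootStep; fun_prop) (fun a => ?_) fun a y hy => ?_
    · have := md_le (g a) (p a)
      simp only [wordsLE_pair, wordsLE_nat]
      omega
    · obtain ⟨E', r, g'⟩ := y
      have hmd (x : ℕ) : WordsLE (p a + E a + 1) (RAM.md x (p a)) :=
        wordsLE_nat.2 ((md_le _ _).trans (by omega))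
      refine .ifz ?_ hy
      simp only [wordsLE_pair] at hy ⊢
      exact ⟨wordsLE_nat.2 ((Nat.div_le_self _ _).trans (wordsLE_nat.1 hy.1)),
        .ifz hy.2.1 (hmd _), hmd _⟩
  unfold RAM.rootMod
  fun_prop

/-- Selective square root: for `x`, `y` nonzero modulo `p`, the result is `(0, s)`, `(1, s)` or
`(2, s)` where `s` is a square root of `x`, of `y` or of `x * y`, respectively. If
`E` is even, one of `x ^ E`, `y ^ E` is `-1`, and that base replaces the nonresidue of the
Tonelli–Shanks algorithm, so that none has to be searched for. -/
def selectRoot (p x y : ℕ) : ℕ × ℕ :=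
  let E' := commonExponent p x y
  let E := ifz (E' % 2) (E' / 2) E'
  ifz (powSubOne p x E) (0, rootMod p x y E)
    (ifz (powSubOne p y E) (1, rootMod p y x E) (2, rootMod p (x * y) x E))

@[fun_prop]
theorem PolyTime.selectRoot {p x y : α → ℕ} (hp : PolyTime p) (hx : PolyTime x)
    (hy : PolyTime y) : PolyTime fun a => selectRoot (p a) (x a) (y a) := by
  unfold RAM.selectRoot; fun_prop

theorem selectRoot_snd_le (p x y : ℕ) : (selectRoot p x y).2 ≤ p := by
  unfold selectRoot ifz rootMod
  dsimp only
  split_ifs <;> exact md_le _ _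

/-- From `m = u ^ 2 + v ^ 2` to a representation of `m + 1` as a sum of two squares modulo `p`:
one of `m`, `m + 1` and `m * (m + 1)` is a square whose root is available. -/
def addOneSq (p : ℕ) (y : ℕ × ℕ) : ℕ × ℕ :=
  let m := md (y.1 * y.1 + y.2 * y.2) p
  ifz m (1, 0) (ifz (md (m + 1) p) (0, 0)
    (let r := selectRoot p m (m + 1);
      ifz r.1 (r.2, 1) (ifz (r.1 - 1) (r.2, 0)
        (let c := r.2 * powMod p m (p - 2);
          (md (c * y.1) p, md (c * y.2) p)))))

@[fun_prop]
theorem PolyTime.addOneSq {p : α → ℕ} {y : α → ℕ × ℕ} (hp : PolyTime p) (hy : PolyTime y) :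
    PolyTime fun a => addOneSq (p a) (y a) := by
  unfold RAM.addOneSq; fun_prop

theorem wordsLE_addOneSq {W p : ℕ} (hp : p + 1 ≤ W) (y : ℕ × ℕ) : WordsLE W (addOneSq p y) := by
  have h (x : ℕ) := (md_le x p).trans ((Nat.le_succ p).trans hp)
  unfold addOneSq
  refine .ifz ?_ (.ifz ?_ (.ifz ?_ (.ifz ?_ ?_))) <;> simp only [wordsLE_pair, wordsLE_nat]
  · omega
  · omega
  · exact ⟨(selectRoot_snd_le _ _ _).trans (by omega), by omega⟩
  · exact ⟨(selectRoot_snd_le _ _ _).trans (by omega), by omega⟩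
  · exact ⟨h _, h _⟩

/-- `2 ^ a.size`. The reduction modulo `2 * a + 2`, which is never reached, makes the bound on the
words evident. -/
def pow2Size (a : ℕ) : ℕ := (fun y => md (2 * y) (2 * a + 2))^[a.size] 1

@[fun_prop]
theorem PolyTime.pow2Size {a : α → ℕ} (ha : PolyTime a) : PolyTime fun x => pow2Size (a x) := by
  unfold RAM.pow2Size
  refine .iterate_of_le (W := fun x => 2 * a x + 2) (F := fun x y => RAM.md (2 * y) (2 * a x + 2))
    ha (by fun_prop) (by fun_prop) (by fun_prop) (fun x => ?_) fun x y _ => ?_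
  · simp only [wordsLE_nat]; omega
  · exact wordsLE_nat.2 (md_le _ _)

/-- The state `(d, u, v)` satisfies `u ^ 2 + v ^ 2 = a / d` modulo `p`, where `d` is a power
of `2`. -/
def twoSqStep (p a : ℕ) (y : ℕ × ℕ × ℕ) : ℕ × ℕ × ℕ :=
  let d := y.1 / 2
  let z := (md (y.2.1 + y.2.2) p, md (y.2.1 + (p - 1) * y.2.2) p)
  (d, ifz (a / d % 2) z (addOneSq p z))

/-- A representation of `a` as a sum of two squares modulo `p`, running through the binary digits
of `a` from the top. Doubling is `2 (u ^ 2 + v ^ 2) = (u + v) ^ 2 + (u - v) ^ 2`. -/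
def twoSq (p a : ℕ) : ℕ × ℕ := ((twoSqStep p a)^[a.size] (pow2Size a, 0, 0)).2

theorem pow2Size_le (a : ℕ) : pow2Size a ≤ 2 * a + 2 := by
  unfold pow2Size
  cases a.size with
  | zero => simp
  | succ n => rw [Function.iterate_succ_apply']; exact md_le _ _

@[fun_prop]
theorem PolyTime.twoSq {p a : α → ℕ} (hp : PolyTime p) (ha : PolyTime a) :
    PolyTime fun x => twoSq (p x) (a x) := by
  unfold RAM.twoSq
  refine .snd (.iterate_of_le (W := fun x => p x + 2 * a x + 2)
    (F := fun x => twoSqStep (p x) (a x)) ha (by fun_prop) (by fun_prop)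
    (by unfold twoSqStep; fun_prop) (fun x => ?_) fun x y hy => ?_)
  · have := pow2Size_le (a x)
    simp only [wordsLE_pair, wordsLE_nat]
    omega
  · have hmd (z : ℕ) : RAM.md z (p x) ≤ p x + 2 * a x + 2 := (md_le _ _).trans (by omega)
    obtain ⟨d, u, v⟩ := y
    rw [wordsLE_pair] at hy
    simp only [twoSqStep]
    rw [wordsLE_pair]
    refine ⟨wordsLE_nat.2 ((Nat.div_le_self _ _).trans (wordsLE_nat.1 hy.1)),
      .ifz ?_ (wordsLE_addOneSq (by omega) _)⟩
    simp only [wordsLE_pair, wordsLE_nat]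
    exact ⟨hmd _, hmd _⟩

/-! ### Coordinate vectors of algebra elements -/

/-- The value `f i` for the first `i` in the list with `test i ≠ 0`, or `d` if there is none. -/
def search {ι : Type} (L : List ι) (test : ι → ℕ) (f : ι → β) (d : β) : β :=
  L.foldr (fun i r => ifz (test i) r (f i)) d

@[fun_prop]
theorem PolyTime.search {ι : Type} {L : List ι} {test : α → ι → ℕ} {f : α → ι → β} {d : α → β}
    (ht : ∀ i, PolyTime fun x => test x i) (hf : ∀ i, PolyTime fun x => f x i)
    (hd : PolyTime d) : PolyTime fun x => search L (test x) (f x) (d x) := by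
  induction L with
  | nil => exact hd
  | cons i L ih => exact .ifz (ht i) ih (hf i)

/-- The structure constant `c i j k`, read off the input tape. -/
def structConst (w : ℕ → ℕ) (i j k : Fin 4) : ℕ :=
  readInput w (1 + 16 * (i : ℕ) + 4 * (j : ℕ) + (k : ℕ))

/-- The product in the algebra modulo `M`. -/
def vmul (w : ℕ → ℕ) (M : ℕ) (x y : Fin 4 → ℕ) : Fin 4 → ℕ :=
  fun k => md (∑ i, ∑ j, structConst w i j k * (x i * y j)) M

/-- The sum modulo `M`. -/
def vadd (M : ℕ) (x y : Fin 4 → ℕ) : Fin 4 → ℕ := fun k => md (x k + y k) M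

/-- The difference modulo `M`. -/
def vsub (M : ℕ) (x y : Fin 4 → ℕ) : Fin 4 → ℕ := fun k => md (x k + (M - 1) * y k) M

/-- The multiple by the scalar `a` modulo `M`. -/
def vsmul (M a : ℕ) (x : Fin 4 → ℕ) : Fin 4 → ℕ := fun k => md (a * x k) M

/-- The `i`-th basis vector. -/
def bvec (i : Fin 4) : Fin 4 → ℕ := Pi.single i 1

/-- The commutator modulo `M`. -/
def comm (w : ℕ → ℕ) (M : ℕ) (x y : Fin 4 → ℕ) : Fin 4 → ℕ :=
  vsub M (vmul w M x y) (vmul w M y x)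

/-- Zero if and only if all entries of `x` vanish modulo `p`. -/
def nonzero (p : ℕ) (x : Fin 4 → ℕ) : ℕ := ∑ k, md (x k) p

section

variable {w : α → ℕ → ℕ} {M : α → ℕ} {x y : α → Fin 4 → ℕ}

@[fun_prop]
theorem PolyTime.structConst (hw : PolyTime w) (i j k : Fin 4) :
    PolyTime fun a => structConst (w a) i j k := by
  unfold RAM.structConst; fun_prop

@[fun_prop]
theorem PolyTime.vmul (hw : PolyTime w) (hM : PolyTime M) (hx : PolyTime x) (hy : PolyTime y) :
    PolyTime fun a => vmul (w a) (M a) (x a) (y a) := by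
  unfold RAM.vmul; fun_prop

@[fun_prop]
theorem PolyTime.vadd (hM : PolyTime M) (hx : PolyTime x) (hy : PolyTime y) :
    PolyTime fun a => vadd (M a) (x a) (y a) := by
  unfold RAM.vadd; fun_prop

@[fun_prop]
theorem PolyTime.vsub (hM : PolyTime M) (hx : PolyTime x) (hy : PolyTime y) :
    PolyTime fun a => vsub (M a) (x a) (y a) := by
  unfold RAM.vsub; fun_prop

@[fun_prop]
theorem PolyTime.vsmul {c : α → ℕ} (hM : PolyTime M) (hc : PolyTime c) (hx : PolyTime x) :
    PolyTime fun a => vsmul (M a) (c a) (x a) := by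
  unfold RAM.vsmul; fun_prop

@[fun_prop]
theorem PolyTime.comm (hw : PolyTime w) (hM : PolyTime M) (hx : PolyTime x) (hy : PolyTime y) :
    PolyTime fun a => comm (w a) (M a) (x a) (y a) := by
  unfold RAM.comm; fun_prop

@[fun_prop]
theorem PolyTime.nonzero (hM : PolyTime M) (hx : PolyTime x) :
    PolyTime fun a => nonzero (M a) (x a) := by
  unfold RAM.nonzero; fun_prop

end

/-! ### The splitting algorithm -/

/-- The vectors `i = [b m, b n]` and `j = [i, b k]` for the first `(m, n, k)` with `j ≠ 0`
modulo `p`. They anticommute and have scalar squares. -/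
noncomputable def anticommPair (w : ℕ → ℕ) (p : ℕ) : (Fin 4 → ℕ) × (Fin 4 → ℕ) :=
  let f := fun m : Fin 4 × Fin 4 × Fin 4 =>
    let i := comm w p (bvec m.1) (bvec m.2.1)
    (i, comm w p i (bvec m.2.2))
  search Finset.univ.toList (fun m => nonzero p (f m).2) f 0

/-- The scalar `a`, if `x` stands for `a • 1`. As the coordinates of the identity are not known, the
scalar is read off the product with a basis vector. -/
def scalarOf (w : ℕ → ℕ) (p : ℕ) (x : Fin 4 → ℕ) : ℕ := vmul w p x (bvec 0) 0

/-- For anticommuting `i`, `j` with scalar squares `a`, `b`, a nonzero zero divisor modulo `p`. If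
neither of `a`, `b` is zero, it is a multiple of `s - i` with `s ^ 2 = a`, of `s - j` with
`s ^ 2 = b`, or, with `s ^ 2 = a b` and `a = u ^ 2 + v ^ 2`, of `u s + s i + v i j`. The square `i2`
serves as a multiple `a • 1` of the identity. -/
def zeroDivisor (w : ℕ → ℕ) (p : ℕ) (i j : Fin 4 → ℕ) : Fin 4 → ℕ :=
  let i2 := vmul w p i i
  let j2 := vmul w p j j
  let a := scalarOf w p i2
  let b := scalarOf w p j2
  let r := selectRoot p a b
  ifz a i (ifz b j (ifz r.1 (vsub p i2 (vsmul p r.2 i)) (ifz (r.1 - 1) (vsub p j2 (vsmul p r.2 j))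
    (let t := twoSq p a;
      vadd p (vsmul p (t.1 * r.2) i2)
        (vadd p (vsmul p (a * r.2) i) (vsmul p (a * t.2) (vmul w p i j)))))))

/-- An idempotent modulo `p` in the right ideal of a zero divisor `z`, obtained from `z b z = t z`
with a scalar `t ≠ 0`. -/
noncomputable def idempotentOf (w : ℕ → ℕ) (p : ℕ) (z : Fin 4 → ℕ) : Fin 4 → ℕ :=
  let c := fun m : Fin 4 × Fin 4 => vmul w p (vmul w p z (bvec m.1)) z m.2
  search Finset.univ.toList c
    (fun m => vsmul p (z m.2 * powMod p (c m) (p - 2)) (vmul w p z (bvec m.1))) 0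

/-- A step `e ↦ 3 e ^ 2 - 2 e ^ 3` of the Newton iteration for idempotents. -/
def liftStep (w : ℕ → ℕ) (Q : ℕ) (e : Fin 4 → ℕ) : Fin 4 → ℕ :=
  vsub Q (vsmul Q 3 (vmul w Q e e)) (vsmul Q 2 (vmul w Q e (vmul w Q e e)))

/-- Newton iteration lifting an idempotent modulo a prime to the prime power `Q`. -/
def liftIdempotent (w : ℕ → ℕ) (Q : ℕ) (e : Fin 4 → ℕ) : Fin 4 → ℕ :=
  (liftStep w Q)^[Q.size] fun k => md (e k) Q

/-- The inverse of a unit modulo a power `Q` of the prime `p`, by Euler's theorem. -/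
def invMod (p Q x : ℕ) : ℕ := powMod Q x (Q / p * (p - 1) - 1)

/-- The coordinates of `e b_i (1 - e) b_j e`, which is a multiple of `e`. -/
def corner (w : ℕ → ℕ) (Q : ℕ) (e : Fin 4 → ℕ) (i j : Fin 4) : Fin 4 → ℕ :=
  vsub Q (vmul w Q (vmul w Q e (bvec i)) (vmul w Q (bvec j) e))
    (vmul w Q (vmul w Q (vmul w Q e (bvec i)) e) (vmul w Q (bvec j) e))

/-- The matrices of the basis vectors with respect to the matrix units built from the idempotent
`e`, from `e b_i (1 - e)` and from a multiple of `(1 - e) b_j e`, for `m = (i, j, l)`. Multiples of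
`e` are identified by their coordinate `l`. -/
def matricesOfCorner (w : ℕ → ℕ) (p Q : ℕ) (e : Fin 4 → ℕ) (m : Fin 4 × Fin 4 × Fin 4) :
    Fin 4 → Fin 2 → Fin 2 → ℕ := fun r s t =>
  let u := vsub Q (vmul w Q e (bvec m.1)) (vmul w Q (vmul w Q e (bvec m.1)) e)
  let v := vsmul Q (e m.2.2 * invMod p Q (corner w Q e m.1 m.2.1 m.2.2))
    (vsub Q (vmul w Q (bvec m.2.1) e) (vmul w Q e (vmul w Q (bvec m.2.1) e)))
  md (vmul w Q (vmul w Q (ifz s e u) (bvec r)) (ifz t e v) m.2.2 * invMod p Q (e m.2.2)) Q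

/-- The matrices of the basis vectors modulo the power `Q` of `p`, with respect to matrix units
whose first one is the idempotent `e`. -/
noncomputable def localMatrices (w : ℕ → ℕ) (p Q : ℕ) (e : Fin 4 → ℕ) :
    Fin 4 → Fin 2 → Fin 2 → ℕ :=
  search Finset.univ.toList (fun m : Fin 4 × Fin 4 × Fin 4 => md (corner w Q e m.1 m.2.1 m.2.2) p)
    (matricesOfCorner w p Q e) 0

/-- Processing the prime power at the current position in the input: its matrices, times the
element of `ℤ/N` that is `1` modulo this prime power and `0` modulo the others, are added up. -/
noncomputable def mainStep (w : ℕ → ℕ) (y : ℕ × (Fin 4 → Fin 2 → Fin 2 → ℕ)) :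
    ℕ × (Fin 4 → Fin 2 → Fin 2 → ℕ) :=
  let N := readInput w 0
  let q := readInput w (65 + 2 * y.1)
  let Q := powMod (N + 1) q (readInput w (66 + 2 * y.1))
  let ij := anticommPair w q
  let e := liftIdempotent w Q (idempotentOf w q (zeroDivisor w q ij.1 ij.2))
  let Z := localMatrices w q Q e
  let E := powMod N (N / Q) (Q / q * (q - 1))
  ifz q y (md (y.1 + 1) (N + 1), fun r s t => md (y.2 r s t + E * Z r s t) N)

/-- The matrices of the basis vectors modulo `N`. The words behind the input are `0`, which is
how the end of the factorization is recognized. -/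
noncomputable def splitting (w : ℕ → ℕ) : Fin 4 → Fin 2 → Fin 2 → ℕ :=
  ((mainStep w)^[(readInput w 0).size] (0, 0)).2

@[fun_prop]
theorem PolyTime.anticommPair {w : α → ℕ → ℕ} {p : α → ℕ} (hw : PolyTime w) (hp : PolyTime p) :
    PolyTime fun a => anticommPair (w a) (p a) := by
  unfold RAM.anticommPair; dsimp only; fun_prop

@[fun_prop]
theorem PolyTime.zeroDivisor {w : α → ℕ → ℕ} {p : α → ℕ} {i j : α → Fin 4 → ℕ} (hw : PolyTime w)
    (hp : PolyTime p) (hi : PolyTime i) (hj : PolyTime j) :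
    PolyTime fun a => zeroDivisor (w a) (p a) (i a) (j a) := by
  unfold RAM.zeroDivisor scalarOf; fun_prop

@[fun_prop]
theorem PolyTime.idempotentOf {w : α → ℕ → ℕ} {p : α → ℕ} {z : α → Fin 4 → ℕ} (hw : PolyTime w)
    (hp : PolyTime p) (hz : PolyTime z) :
    PolyTime fun a => idempotentOf (w a) (p a) (z a) := by
  unfold RAM.idempotentOf; dsimp only; fun_prop

@[fun_prop]
theorem PolyTime.liftIdempotent {w : α → ℕ → ℕ} {Q : α → ℕ} {e : α → Fin 4 → ℕ}
    (hw : PolyTime w) (hQ : PolyTime Q) (he : PolyTime e) :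
    PolyTime fun a => liftIdempotent (w a) (Q a) (e a) := by
  unfold RAM.liftIdempotent
  refine .iterate_of_le (W := Q) (F := fun a => liftStep (w a) (Q a)) hQ hQ (by fun_prop)
    (by unfold liftStep; fun_prop) (fun a => ?_) fun a y _ => ?_ <;>
  exact wordsLE_pi.2 fun k => wordsLE_nat.2 (md_le _ _)

@[fun_prop]
theorem PolyTime.localMatrices {w : α → ℕ → ℕ} {p Q : α → ℕ} {e : α → Fin 4 → ℕ}
    (hw : PolyTime w) (hp : PolyTime p) (hQ : PolyTime Q) (he : PolyTime e) :
    PolyTime fun a => localMatrices (w a) (p a) (Q a) (e a) := by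
  unfold RAM.localMatrices matricesOfCorner corner invMod; dsimp only; fun_prop

theorem PolyTime.splitting : PolyTime splitting := by
  unfold RAM.splitting
  refine .snd (.iterate_of_le (W := fun w => RAM.readInput w 0 + 1) (F := mainStep) (by fun_prop)
    (by fun_prop) (by fun_prop) (by unfold mainStep; fun_prop) (fun w => ?_) fun w y hy => ?_)
  · refine wordsLE_pair.2 ⟨?_, ?_⟩
    · simp
    · simp only [wordsLE_pi, wordsLE_nat]; intros; simp
  · refine .ifz hy (wordsLE_pair.2 ⟨wordsLE_nat.2 (md_le _ _), ?_⟩)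
    simp only [wordsLE_pi, wordsLE_nat]
    exact fun _ _ _ => (md_le _ _).trans (Nat.le_succ _)

/-! ### Correctness of the modular arithmetic -/

section Cast

variable {R : Type*} [CommRing R] {M : ℕ}

theorem md_of_lt {x M : ℕ} (h : x < M) : md x M = x := by
  rw [md, Nat.sub_add_cancel (by omega), Nat.mod_eq_of_lt h]

theorem cast_md (hM : M ≠ 0) (hR : (M : R) = 0) (x : ℕ) : ((md x M : ℕ) : R) = x := by
  rw [md, Nat.sub_add_cancel (Nat.pos_of_ne_zero hM)]
  conv_rhs => rw [← Nat.div_add_mod x M]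
  simp [hR]

theorem cast_pred (hM : M ≠ 0) (hR : (M : R) = 0) : ((M - 1 : ℕ) : R) = -1 := by
  rw [Nat.cast_sub (Nat.pos_of_ne_zero hM), hR]; simp

theorem md_eq_zero_iff (hM : M ≠ 0) (x : ℕ) : md x M = 0 ↔ (x : ZMod M) = 0 := by
  rw [md, Nat.sub_add_cancel (Nat.pos_of_ne_zero hM), ZMod.natCast_eq_zero_iff,
    Nat.dvd_iff_mod_eq_zero]

theorem cast_iterate_powStep (hM : M ≠ 0) (hR : (M : R) = 0) (n : ℕ) (y : ℕ × ℕ × ℕ)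
    (hy : y.2.2 < 2 ^ n) :
    ((((powStep M)^[n] y).1 : ℕ) : R) = y.1 * (y.2.1 : R) ^ y.2.2 := by
  induction n generalizing y with
  | zero => simp [Nat.lt_one_iff.1 hy]
  | succ n ih =>
    rw [Function.iterate_succ_apply, ih _ (by simp only [powStep]; omega)]
    simp only [powStep, cast_md hM hR, Nat.cast_mul]
    conv_rhs => rw [← Nat.div_add_mod y.2.2 2, pow_add, pow_mul]
    rcases Nat.mod_two_eq_zero_or_one y.2.2 with h | h
    · simp [h, ifz, pow_two]
    · simp only [h, ifz, one_ne_zero, if_false, cast_md hM hR, Nat.cast_mul, pow_one]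
      ring

theorem cast_powMod (hM : M ≠ 0) (hR : (M : R) = 0) (b e : ℕ) :
    ((powMod M b e : ℕ) : R) = (b : R) ^ e := by
  rw [powMod, cast_iterate_powStep hM hR _ _ (Nat.lt_size_self e)]
  simp [cast_md hM hR]

end Cast

theorem powMod_lt {M : ℕ} (hM : M ≠ 0) (b e : ℕ) : powMod M b e < M := by
  have h : ∀ n y, y.1 < M → ((powStep M)^[n] y).1 < M := by
    intro n
    induction n with
    | zero => exact fun y hy => hy
    | succ n ih =>
      intro y hy
      rw [Function.iterate_succ_apply]
      refine ih _ ?_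
      simp only [powStep, ifz, md, Nat.sub_add_cancel (Nat.pos_of_ne_zero hM)]
      split
      · exact hy
      · exact Nat.mod_lt _ (Nat.pos_of_ne_zero hM)
  refine h _ _ ?_
  simp only [md, Nat.sub_add_cancel (Nat.pos_of_ne_zero hM)]
  exact Nat.mod_lt _ (Nat.pos_of_ne_zero hM)

theorem powMod_of_lt {M b e : ℕ} (h : b ^ e < M) : powMod M b e = b ^ e := by
  have hM : M ≠ 0 := by omega
  have h1 := cast_powMod (R := ZMod M) hM (ZMod.natCast_self M) b e
  rw [← Nat.cast_pow, ZMod.natCast_eq_natCast_iff'] at h1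
  rwa [Nat.mod_eq_of_lt (powMod_lt hM b e), Nat.mod_eq_of_lt h] at h1

theorem powSubOne_eq_zero_iff {p : ℕ} (hp : p ≠ 0) (x E : ℕ) :
    powSubOne p x E = 0 ↔ (x : ZMod p) ^ E = 1 := by
  rw [powSubOne, md_eq_zero_iff hp, Nat.cast_add, cast_powMod hp (ZMod.natCast_self p),
    cast_pred hp (ZMod.natCast_self p), add_neg_eq_zero]

/-- An iteration that halves the positive measure `μ` until `done` holds is done after as many
rounds as `μ` has binary digits. -/
theorem iterate_halving {α : Type*} {f : α → α} {I done : α → Prop} {μ : α → ℕ}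
    (hI : ∀ y, I y → I (f y)) (hd : ∀ y, done y → f y = y)
    (hμ : ∀ y, I y → ¬ done y → 2 * μ (f y) ≤ μ y) (h0 : ∀ y, I y → 0 < μ y)
    (n : ℕ) (y : α) (hy : I y) (h : μ y < 2 ^ n) : I (f^[n] y) ∧ done (f^[n] y) := by
  induction n generalizing y with
  | zero => have := h0 y hy; omega
  | succ n ih =>
    by_cases hdy : done y
    · rw [Function.iterate_fixed (hd y hdy)]
      exact ⟨hy, hdy⟩
    · rw [Function.iterate_succ_apply]
      have := hμ y hy hdy
      exact ih _ (hI y hy) (by omega)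

section Prime

variable {p : ℕ} [hp : Fact p.Prime]

theorem pow_sub_two_eq_inv {x : ZMod p} (hx : x ≠ 0) : x ^ (p - 2) = x⁻¹ := by
  refine eq_inv_of_mul_eq_one_left ?_
  rw [← pow_succ, show p - 2 + 1 = p - 1 by have := hp.out.two_le; omega]
  exact ZMod.pow_card_sub_one_eq_one hx

theorem commonExponent_spec {x y : ℕ} (hx : (x : ZMod p) ≠ 0) (hy : (y : ZMod p) ≠ 0) :
    let E := commonExponent p x y
    (0 < E ∧ E ≤ p ∧ (x : ZMod p) ^ E = 1 ∧ (y : ZMod p) ^ E = 1) ∧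
      (E % 2 = 0 → ¬ ((x : ZMod p) ^ (E / 2) = 1 ∧ (y : ZMod p) ^ (E / 2) = 1)) := by
  have hp0 := hp.out.ne_zero
  have h := iterate_halving (f := halveStep p x y) (μ := fun E => E)
    (I := fun E => 0 < E ∧ E ≤ p ∧ (x : ZMod p) ^ E = 1 ∧ (y : ZMod p) ^ E = 1)
    (done := fun E => E % 2 + powSubOne p x (E / 2) + powSubOne p y (E / 2) ≠ 0)
    ?_ ?_ ?_ ?_ p.size (p - 1) ?_ ?_
  · refine ⟨h.1, fun h2 h3 => h.2 ?_⟩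
    change commonExponent p x y % 2 + powSubOne p x (commonExponent p x y / 2) +
      powSubOne p y (commonExponent p x y / 2) = 0
    rw [(powSubOne_eq_zero_iff hp0 _ _).2 h3.1, (powSubOne_eq_zero_iff hp0 _ _).2 h3.2, h2]
  · rintro E ⟨h1, h2, h3, h4⟩
    unfold halveStep ifz
    split_ifs with hc
    · simp only [Nat.add_eq_zero_iff, powSubOne_eq_zero_iff hp0] at hc
      exact ⟨by omega, by omega, hc.1.2, hc.2⟩
    · exact ⟨h1, h2, h3, h4⟩
  · intro E hE
    exact if_neg hE
  · intro E _ hE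
    rw [not_not] at hE
    rw [halveStep, ifz, if_pos hE]
    omega
  · exact fun E hE => hE.1
  · have := hp.out.two_le
    exact ⟨by omega, by omega, ZMod.pow_card_sub_one_eq_one hx, ZMod.pow_card_sub_one_eq_one hy⟩
  · exact (Nat.sub_le _ _).trans_lt (Nat.lt_size_self p)

theorem rootMod_sq {z g E : ℕ} (hE : 0 < E) (hEp : E ≤ p) (hz : (z : ZMod p) ^ E = 1)
    (hg : E % 2 = 0 → (g : ZMod p) ^ E = -1) : ((rootMod p z g E : ℕ) : ZMod p) ^ 2 = z := by
  have hp0 := hp.out.ne_zero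
  have hpp := ZMod.natCast_self p
  have h := iterate_halving (f := rootStep p z) (μ := fun y => y.1)
    (I := fun y : ℕ × ℕ × ℕ => 0 < y.1 ∧ (y.2.1 : ZMod p) ≠ 0 ∧
      (z * (y.2.1 : ZMod p) ^ 2) ^ y.1 = 1 ∧ (y.1 % 2 = 0 → (y.2.2 : ZMod p) ^ y.1 = -1))
    (done := fun y => y.1 % 2 ≠ 0) ?_ ?_ ?_ ?_ p.size (E, 1, md g p) ?_ ?_
  · obtain ⟨⟨-, h2, h3, -⟩, h4⟩ := h
    rw [rootMod]
    set y := (rootStep p z)^[p.size] (E, 1, md g p)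
    simp only [cast_md hp0 hpp, cast_powMod hp0 hpp, Nat.cast_mul, pow_sub_two_eq_inv h2]
    rw [mul_pow, ← pow_mul, show (y.1 + 1) / 2 * 2 = y.1 + 1 by omega, pow_succ,
      show (z : ZMod p) * y.2.1 * y.2.1 = z * (y.2.1 : ZMod p) ^ 2 by ring, h3]
    field_simp
  · rintro ⟨E, r, g⟩ ⟨h1, h2, h3, h4⟩
    dsimp only at h1 h2 h3 h4
    simp only [rootStep]
    by_cases hE2 : E % 2 = 0
    · have h4 := h4 hE2
      obtain ⟨n, rfl⟩ : ∃ n, E = 2 * n := ⟨E / 2, by omega⟩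
      rw [ifz, if_pos hE2]
      have hg0 : (g : ZMod p) ≠ 0 := by
        rintro h0
        rw [h0, zero_pow (by omega)] at h4
        exact neg_ne_zero.2 one_ne_zero h4.symm
      have hdiv : 2 * n / 2 = n := by omega
      refine ⟨by dsimp only; omega, ?_, ?_, fun _ => ?_⟩
      · dsimp only [ifz]
        split
        · exact h2
        · rw [cast_md hp0 hpp, Nat.cast_mul]; exact mul_ne_zero h2 hg0
      · dsimp only [ifz]
        rw [hdiv]
        have hsq : (z * (r : ZMod p) ^ 2) ^ n * (z * (r : ZMod p) ^ 2) ^ n = 1 := by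
          rw [← pow_add, ← two_mul, h3]
        split
        · rename_i hc
          rw [powSubOne_eq_zero_iff hp0] at hc
          rw [← hc]; push_cast; ring
        · rename_i hc
          rw [powSubOne_eq_zero_iff hp0] at hc
          have hne : (z * (r : ZMod p) ^ 2) ^ n ≠ 1 := by
            rw [show (z * (r : ZMod p) ^ 2) = ((z * r * r : ℕ) : ZMod p) by push_cast; ring]
            exact hc
          -- The power is `1` or `-1`, and multiplying `r` by `g` changes its sign.
          rw [cast_md hp0 hpp, Nat.cast_mul, mul_pow (r : ZMod p), ← mul_assoc, mul_pow,
            ← pow_mul (g : ZMod p), h4, (mul_self_eq_one_iff.1 hsq).resolve_left hne,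
            neg_mul_neg, one_mul]
      · rw [cast_md hp0 hpp, Nat.cast_mul, ← pow_two, ← pow_mul, hdiv, h4]
    · rw [ifz, if_neg hE2]
      exact ⟨h1, h2, h3, h4⟩
  · exact fun y hy => if_neg hy
  · intro y _ hy
    rw [not_not] at hy
    rw [rootStep, ifz, if_pos hy]
    dsimp only
    omega
  · exact fun y hy => hy.1
  · simp only [cast_md hp0 hpp]
    refine ⟨hE, by simp, ?_, hg⟩
    simpa using hz
  · exact hEp.trans_lt (Nat.lt_size_self p)

/-- In the last two cases `p` is odd. -/
theorem selectRoot_spec {x y : ℕ} (hx : (x : ZMod p) ≠ 0) (hy : (y : ZMod p) ≠ 0) :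
    let r := selectRoot p x y
    (r.1 = 0 ∧ (r.2 : ZMod p) ^ 2 = x) ∨ (r.1 = 1 ∧ (r.2 : ZMod p) ^ 2 = y ∧ (2 : ZMod p) ≠ 0) ∨
      (r.1 = 2 ∧ (r.2 : ZMod p) ^ 2 = x * y ∧ (2 : ZMod p) ≠ 0) := by
  have hp0 := hp.out.ne_zero
  obtain ⟨⟨h1, h2, h3, h4⟩, h5⟩ := commonExponent_spec hx hy
  unfold selectRoot
  set E' := commonExponent p x y
  dsimp only
  by_cases hE : E' % 2 = 0
  · obtain ⟨n, hn⟩ : ∃ n, E' = 2 * n := ⟨E' / 2, by omega⟩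
    have h5 := h5 hE
    have hsign {t : ZMod p} (ht : t ^ E' = 1) (hne : t ^ n ≠ 1) : t ^ n = -1 := by
      refine (mul_self_eq_one_iff.1 ?_).resolve_left hne
      rw [← pow_add, ← two_mul, ← hn, ht]
    have htwo {t : ZMod p} (h : t = -1) (hne : t ≠ 1) : (2 : ZMod p) ≠ 0 := fun h2 =>
      hne (by linear_combination h - h2)
    rw [show E' / 2 = n by omega] at h5 ⊢
    rw [show ifz (E' % 2) n E' = n from if_pos hE]
    have hn0 : 0 < n := by omega
    have hnp : n ≤ p := by omega
    unfold ifz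
    by_cases hxn : (x : ZMod p) ^ n = 1
    · rw [if_pos ((powSubOne_eq_zero_iff hp0 _ _).2 hxn)]
      exact .inl ⟨rfl, rootMod_sq hn0 hnp hxn fun _ => hsign h4 fun h => h5 ⟨hxn, h⟩⟩
    · rw [if_neg (mt (powSubOne_eq_zero_iff hp0 _ _).1 hxn)]
      have hxs := hsign h3 hxn
      by_cases hyn : (y : ZMod p) ^ n = 1
      · rw [if_pos ((powSubOne_eq_zero_iff hp0 _ _).2 hyn)]
        exact .inr (.inl ⟨rfl, rootMod_sq hn0 hnp hyn fun _ => hxs, htwo hxs hxn⟩)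
      · rw [if_neg (mt (powSubOne_eq_zero_iff hp0 _ _).1 hyn)]
        refine .inr (.inr ⟨rfl, ?_, htwo hxs hxn⟩)
        rw [rootMod_sq hn0 hnp ?_ fun _ => hxs, Nat.cast_mul]
        rw [Nat.cast_mul, mul_pow, hxs, hsign h4 hyn, neg_mul_neg, one_mul]
  · rw [show ifz (E' % 2) (E' / 2) E' = E' from if_neg hE, ifz,
      if_pos ((powSubOne_eq_zero_iff hp0 _ _).2 h3)]
    exact .inl ⟨rfl, rootMod_sq h1 h2 h3 fun h => absurd h hE⟩

theorem addOneSq_spec (y : ℕ × ℕ) :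
    ((addOneSq p y).1 : ZMod p) ^ 2 + ((addOneSq p y).2 : ZMod p) ^ 2 =
      (y.1 : ZMod p) ^ 2 + (y.2 : ZMod p) ^ 2 + 1 := by
  have hp0 := hp.out.ne_zero
  have hpp := ZMod.natCast_self p
  set m := md (y.1 * y.1 + y.2 * y.2) p with hm
  have hmc : (m : ZMod p) = (y.1 : ZMod p) ^ 2 + (y.2 : ZMod p) ^ 2 := by
    rw [hm, cast_md hp0 hpp]; push_cast; ring
  simp only [addOneSq, ← hm, ← hmc]
  by_cases h0 : m = 0
  · simp [ifz, h0]
  rw [ifz, if_neg h0]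
  have hm0 : (m : ZMod p) ≠ 0 := by
    rw [hm, cast_md hp0 hpp]
    exact mt (md_eq_zero_iff hp0 _).2 h0
  by_cases h1 : md (m + 1) p = 0
  · rw [ifz, if_pos h1]
    rw [md_eq_zero_iff hp0] at h1
    push_cast at h1
    simp [h1]
  rw [ifz, if_neg h1]
  have hm1 : ((m + 1 : ℕ) : ZMod p) ≠ 0 := mt (md_eq_zero_iff hp0 _).2 h1
  rcases selectRoot_spec hm0 hm1 with ⟨hr, hs⟩ | ⟨hr, hs, -⟩ | ⟨hr, hs, -⟩
  · simp [ifz, hr, hs]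
  · simp [ifz, hr, hs]
  · simp only [ifz, hr, OfNat.ofNat_ne_zero, if_false, Nat.reduceSub, one_ne_zero, cast_md hp0 hpp,
      Nat.cast_mul, cast_powMod hp0 hpp, pow_sub_two_eq_inv hm0]
    -- `m (m + 1) = s ^ 2` gives `m + 1 = (s / m) ^ 2 m`.
    push_cast at hs
    have : ∀ c : ZMod p, (c * y.1) ^ 2 + (c * y.2) ^ 2 = c ^ 2 * m := fun c => by rw [hmc]; ring
    rw [this, mul_pow, hs]
    field_simp

theorem pow2Size_eq (a : ℕ) : pow2Size a = 2 ^ a.size := by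
  have h : ∀ k ≤ a.size, (fun y => md (2 * y) (2 * a + 2))^[k] 1 = 2 ^ k := by
    intro k
    induction k with
    | zero => simp
    | succ k ih =>
      intro hk
      have hka : 2 ^ k ≤ a := Nat.lt_size.1 hk
      rw [Function.iterate_succ_apply', ih (by omega), md_of_lt (by omega), pow_succ, mul_comm]
  exact h _ le_rfl

theorem twoSq_spec (a : ℕ) :
    ((twoSq p a).1 : ZMod p) ^ 2 + ((twoSq p a).2 : ZMod p) ^ 2 = a := by
  have hp0 := hp.out.ne_zero
  have hpp := ZMod.natCast_self p
  have h : ∀ k m, k + m = a.size →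
      let y := (twoSqStep p a)^[k] (pow2Size a, 0, 0)
      y.1 = 2 ^ m ∧ (y.2.1 : ZMod p) ^ 2 + (y.2.2 : ZMod p) ^ 2 = (a / 2 ^ m : ℕ) := by
    intro k
    induction k with
    | zero =>
      intro m hm
      rw [Nat.zero_add] at hm
      subst hm
      simp [pow2Size_eq, Nat.div_eq_of_lt (Nat.lt_size_self a)]
    | succ k ih =>
      intro m hm
      obtain ⟨h1, h2⟩ := ih (m + 1) (by omega)
      rw [Function.iterate_succ_apply']
      set y := (twoSqStep p a)^[k] (pow2Size a, 0, 0)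
      have hd : y.1 / 2 = 2 ^ m := by rw [h1, pow_succ]; omega
      simp only [twoSqStep, hd, true_and]
      have hz : (md (y.2.1 + y.2.2) p : ZMod p) ^ 2 +
          (md (y.2.1 + (p - 1) * y.2.2) p : ZMod p) ^ 2 = 2 * (a / 2 ^ (m + 1) : ℕ) := by
        rw [← h2]
        simp only [cast_md hp0 hpp, Nat.cast_add, Nat.cast_mul, cast_pred hp0 hpp]
        ring
      have ha : a / 2 ^ m = 2 * (a / 2 ^ (m + 1)) + a / 2 ^ m % 2 := by
        rw [pow_succ, ← Nat.div_div_eq_div_mul]; omega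
      rcases Nat.mod_two_eq_zero_or_one (a / 2 ^ m) with h | h
      · rw [h, ifz, if_pos rfl, hz, ha, h]; push_cast; ring
      · rw [h, ifz, if_neg one_ne_zero, addOneSq_spec, hz, ha, h]; push_cast; ring
  simpa [twoSq] using (h a.size 0 rfl).2

end Prime

open Matrix

/-! ### Two-by-two matrices -/

section Matrices

variable {R : Type*} [CommRing R]

/-- The basic property of elements of rank one: it yields idempotents from zero divisors, and it
identifies the corner ring of an idempotent of rank one with the scalars. -/
theorem mul_mul_eq_trace_smul {Z : Matrix (Fin 2) (Fin 2) R} (hZ : Z.det = 0)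
    (X : Matrix (Fin 2) (Fin 2) R) : Z * X * Z = (Z * X).trace • Z := by
  rw [det_fin_two] at hZ
  ext i j
  fin_cases i <;> fin_cases j <;>
    simp [Matrix.mul_apply, Fin.sum_univ_two, trace_fin_two]
  · linear_combination -(X 1 1) * hZ
  · linear_combination (X 0 1) * hZ
  · linear_combination (X 1 0) * hZ
  · linear_combination -(X 0 0) * hZ

theorem sq_eq_smul_one_of_trace_eq_zero {C : Matrix (Fin 2) (Fin 2) R} (hC : C.trace = 0) :
    C * C = (-C.det) • 1 := by
  rw [trace_fin_two] at hC
  ext i j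
  fin_cases i <;> fin_cases j <;>
    simp [Matrix.mul_apply, Fin.sum_univ_two, det_fin_two]
  · linear_combination (C 0 0) * hC
  · linear_combination (C 0 1) * hC
  · linear_combination (C 1 0) * hC
  · linear_combination (C 1 1) * hC

theorem trace_commutator (X Y : Matrix (Fin 2) (Fin 2) R) : (X * Y - Y * X).trace = 0 := by
  rw [trace_sub, trace_mul_comm, sub_self]

theorem anticommute_commutator {C Z : Matrix (Fin 2) (Fin 2) R} {a : R} (hC : C * C = a • 1) :
    C * (C * Z - Z * C) = -((C * Z - Z * C) * C) := by
  have h1 : C * (C * Z) = a • Z := by rw [← mul_assoc, hC, smul_mul_assoc, one_mul]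
  have h2 : Z * C * C = a • Z := by rw [mul_assoc, hC, mul_smul_comm, mul_one]
  rw [mul_sub, sub_mul, h1, h2, ← mul_assoc]
  abel

theorem eq_zero_or_eq_zero_of_forall_mul [IsDomain R] {A B : Matrix (Fin 2) (Fin 2) R}
    (h : ∀ X, A * X * B = 0) : A = 0 ∨ B = 0 := by
  by_contra hAB
  rw [not_or] at hAB
  obtain ⟨i, j, hij⟩ : ∃ i j, A i j ≠ 0 := by
    by_contra hc
    push Not at hc
    exact hAB.1 (Matrix.ext hc)
  obtain ⟨k, l, hkl⟩ : ∃ i j, B i j ≠ 0 := by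
    by_contra hc
    push Not at hc
    exact hAB.2 (Matrix.ext hc)
  have := congrFun (congrFun (h (Matrix.single j k 1)) i) l
  rw [Matrix.mul_apply, Finset.sum_eq_single k] at this
  · simp [Matrix.mul_single_apply_same, hij, hkl] at this
  · intro m _ hm
    rw [Matrix.mul_single_apply_of_ne _ _ _ _ _ hm, zero_mul]
  · simp

theorem det_eq_zero_of_mul_eq_zero {K : Type*} [Field K] {Z W : Matrix (Fin 2) (Fin 2) K}
    (h : Z * W = 0) (hW : W ≠ 0) : Z.det = 0 := by
  by_contra hd
  have hu : IsUnit Z := (Matrix.isUnit_iff_isUnit_det Z).2 (isUnit_iff_ne_zero.2 hd)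
  exact hW (hu.mul_right_eq_zero.1 h)

theorem basis_induction {M ι : Type*} [AddCommGroup M] [Module R M] [Finite ι]
    (b : Module.Basis ι R M) {P : M → Prop} (h0 : P 0) (hadd : ∀ x y, P x → P y → P (x + y))
    (hsmul : ∀ (r : R) x, P x → P (r • x)) (hb : ∀ i, P (b i)) (x : M) : P x := by
  have := Fintype.ofFinite ι
  rw [← b.sum_repr x]
  exact Finset.sum_induction _ P hadd h0 fun i _ => hsmul _ _ (hb i)

/-- Iterated commutators of matrices do not all vanish, in characteristic `2` included. -/
theorem exists_commutator_ne_zero [Nontrivial R] {ι : Type*} [Finite ι]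
    (b : Module.Basis ι R (Matrix (Fin 2) (Fin 2) R)) :
    ∃ m n k, (b m * b n - b n * b m) * b k - b k * (b m * b n - b n * b m) ≠ 0 := by
  by_contra! h
  have h3 : ∀ Z m n, (b m * b n - b n * b m) * Z - Z * (b m * b n - b n * b m) = 0 := by
    intro Z m n
    refine basis_induction b (P := fun Z => (b m * b n - b n * b m) * Z -
      Z * (b m * b n - b n * b m) = 0) (by simp) ?_ ?_ (h m n) Z
    · intro x y hx hy
      rw [mul_add, add_mul, add_sub_add_comm, hx, hy, add_zero]
    · intro r x hx
      rw [mul_smul_comm, smul_mul_assoc, ← smul_sub, hx, smul_zero]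
  have h2 : ∀ Y Z m, (b m * Y - Y * b m) * Z - Z * (b m * Y - Y * b m) = 0 := by
    intro Y Z m
    refine basis_induction b (P := fun Y => (b m * Y - Y * b m) * Z - Z * (b m * Y - Y * b m) = 0)
      (by simp) ?_ ?_ (fun n => h3 Z m n) Y
    · intro x y hx hy
      linear_combination (norm := noncomm_ring) hx + hy
    · intro r x hx
      rw [mul_smul_comm, smul_mul_assoc, ← smul_sub, mul_smul_comm, smul_mul_assoc, ← smul_sub, hx,
        smul_zero]
  have h1 : ∀ X Y Z : Matrix (Fin 2) (Fin 2) R,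
      (X * Y - Y * X) * Z - Z * (X * Y - Y * X) = 0 := by
    intro X Y Z
    refine basis_induction b (P := fun X => (X * Y - Y * X) * Z - Z * (X * Y - Y * X) = 0)
      (by simp) ?_ ?_ (fun n => h2 Y Z n) X
    · intro x y hx hy
      linear_combination (norm := noncomm_ring) hx + hy
    · intro r x hx
      rw [mul_smul_comm, smul_mul_assoc, ← smul_sub, mul_smul_comm, smul_mul_assoc, ← smul_sub, hx,
        smul_zero]
  have := congrFun (congrFun (h1 !![1, 0; 0, 0] !![0, 1; 0, 0] !![0, 0; 1, 0]) 0) 0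
  simp at this

end Matrices

/-! ### Elements with given coordinates -/

section Coordinates

variable {R : Type*} [CommRing R]

/-- The matrix with coordinates `x` in the basis `b`. -/
def elt (b : Fin 4 → Matrix (Fin 2) (Fin 2) R) (x : Fin 4 → ℕ) : Matrix (Fin 2) (Fin 2) R :=
  ∑ k, (x k : R) • b k

/-- The products of the `b i` are those of the table on the input tape `w`. -/
def IsTable (w : ℕ → ℕ) (b : Fin 4 → Matrix (Fin 2) (Fin 2) R) : Prop :=
  ∀ i j, b i * b j = ∑ k, (structConst w i j k : R) • b k

variable {w : ℕ → ℕ} {b : Fin 4 → Matrix (Fin 2) (Fin 2) R} {M : ℕ}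

theorem elt_vmul (hw : IsTable w b) (hM : M ≠ 0) (hR : (M : R) = 0) (x y : Fin 4 → ℕ) :
    elt b (vmul w M x y) = elt b x * elt b y := by
  simp only [elt, vmul, cast_md hM hR, Nat.cast_sum, Nat.cast_mul, Finset.sum_mul_sum,
    smul_mul_smul_comm, hw _ _, Finset.smul_sum, Finset.sum_smul, smul_smul]
  rw [Finset.sum_comm]
  refine Finset.sum_congr rfl fun i _ => ?_
  rw [Finset.sum_comm]
  refine Finset.sum_congr rfl fun j _ => Finset.sum_congr rfl fun k _ => ?_
  rw [mul_comm]

theorem elt_vadd (hM : M ≠ 0) (hR : (M : R) = 0) (x y : Fin 4 → ℕ) :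
    elt b (vadd M x y) = elt b x + elt b y := by
  simp only [elt, vadd, cast_md hM hR, Nat.cast_add, add_smul, Finset.sum_add_distrib]

theorem elt_vsub (hM : M ≠ 0) (hR : (M : R) = 0) (x y : Fin 4 → ℕ) :
    elt b (vsub M x y) = elt b x - elt b y := by
  simp only [elt, vsub, cast_md hM hR, Nat.cast_add, Nat.cast_mul, cast_pred hM hR, neg_one_mul,
    ← sub_eq_add_neg, sub_smul, Finset.sum_sub_distrib]

theorem elt_vsmul (hM : M ≠ 0) (hR : (M : R) = 0) (a : ℕ) (x : Fin 4 → ℕ) :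
    elt b (vsmul M a x) = (a : R) • elt b x := by
  simp only [elt, vsmul, cast_md hM hR, Nat.cast_mul, mul_smul, Finset.smul_sum]

theorem elt_bvec (i : Fin 4) : elt b (bvec i) = b i := by
  rw [elt, Finset.sum_eq_single i]
  · simp [bvec]
  · intro j _ hj; simp [bvec, hj]
  · simp

theorem elt_comm (hw : IsTable w b) (hM : M ≠ 0) (hR : (M : R) = 0) (x y : Fin 4 → ℕ) :
    elt b (comm w M x y) = elt b x * elt b y - elt b y * elt b x := by
  rw [comm, elt_vsub hM hR, elt_vmul hw hM hR, elt_vmul hw hM hR]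

theorem repr_elt (b : Module.Basis (Fin 4) R (Matrix (Fin 2) (Fin 2) R)) (x : Fin 4 → ℕ)
    (k : Fin 4) : b.repr (elt b x) k = x k := by
  rw [elt, b.repr_sum_self]

theorem nonzero_eq_zero_iff {p : ℕ} (hp : p ≠ 0)
    (b : Module.Basis (Fin 4) (ZMod p) (Matrix (Fin 2) (Fin 2) (ZMod p))) (x : Fin 4 → ℕ) :
    nonzero p x = 0 ↔ elt b x = 0 := by
  rw [nonzero, Finset.sum_eq_zero_iff, ← b.repr.map_eq_zero_iff, Finsupp.ext_iff]
  simp only [Finset.mem_univ, true_imp_iff, md_eq_zero_iff hp, repr_elt, Finsupp.coe_zero,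
    Pi.zero_apply]

theorem search_spec {ι β : Type} {L : List ι} {test : ι → ℕ} {f : ι → β} {d : β}
    (h : ∃ i ∈ L, test i ≠ 0) : ∃ i, test i ≠ 0 ∧ search L test f d = f i := by
  induction L with
  | nil => simp at h
  | cons i L ih =>
    rw [search, List.foldr_cons, ifz]
    split
    · rename_i hi
      refine ih ?_
      simpa [hi] using h
    · rename_i hi
      exact ⟨i, hi, rfl⟩

end Coordinates

/-! ### Correctness modulo a prime -/

section Field

variable {p : ℕ} [hp : Fact p.Prime] {w : ℕ → ℕ}
  {b : Module.Basis (Fin 4) (ZMod p) (Matrix (Fin 2) (Fin 2) (ZMod p))}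

theorem anticommPair_spec (hw : IsTable w b) :
    ∃ X Y Z : Matrix (Fin 2) (Fin 2) (ZMod p),
      elt b (anticommPair w p).1 = X * Y - Y * X ∧
      elt b (anticommPair w p).2 =
        elt b (anticommPair w p).1 * Z - Z * elt b (anticommPair w p).1 ∧
      elt b (anticommPair w p).2 ≠ 0 := by
  have hp0 := hp.out.ne_zero
  have hpp := ZMod.natCast_self p
  obtain ⟨m, n, k, hmnk⟩ := exists_commutator_ne_zero b
  unfold anticommPair
  dsimp only
  obtain ⟨⟨m, n, k⟩, h1, h2⟩ := search_spec (ι := Fin 4 × Fin 4 × Fin 4) (d := 0)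
    (L := Finset.univ.toList)
    (test := fun m => nonzero p (comm w p (comm w p (bvec m.1) (bvec m.2.1)) (bvec m.2.2)))
    (f := fun m => (comm w p (bvec m.1) (bvec m.2.1),
      comm w p (comm w p (bvec m.1) (bvec m.2.1)) (bvec m.2.2)))
    ⟨(m, n, k), by simp, by
      rw [Ne, nonzero_eq_zero_iff hp0 b]
      simpa only [elt_comm hw hp0 hpp, elt_bvec] using hmnk⟩
  rw [h2]
  rw [Ne, nonzero_eq_zero_iff hp0 b] at h1
  exact ⟨b m, b n, b k, by simp only [elt_comm hw hp0 hpp, elt_bvec],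
    by simp only [elt_comm hw hp0 hpp, elt_bvec], h1⟩

theorem cast_scalarOf (hw : IsTable w b) {x : Fin 4 → ℕ} {a : ZMod p} (hx : elt b x = a • 1) :
    (scalarOf w p x : ZMod p) = a := by
  have hp0 := hp.out.ne_zero
  have hpp := ZMod.natCast_self p
  rw [scalarOf, ← repr_elt b, elt_vmul hw hp0 hpp, hx, elt_bvec, smul_mul_assoc, one_mul]
  simp

variable {K : Type*} [Field K] {I J Z : Matrix (Fin 2) (Fin 2) K}

/-- As `I` does not commute with `Z`, it is no scalar. -/
theorem smul_one_add_smul_ne_zero (hJ : J = I * Z - Z * I) (hJ0 : J ≠ 0) {d : K} (hd : d ≠ 0)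
    (c : K) : c • (1 : Matrix (Fin 2) (Fin 2) K) + d • I ≠ 0 := by
  intro h
  have h1 : d • (I * Z - Z * I) = 0 := by
    have h2 : (c • (1 : Matrix (Fin 2) (Fin 2) K) + d • I) * Z -
        Z * (c • (1 : Matrix (Fin 2) (Fin 2) K) + d • I) = 0 := by rw [h]; simp
    rw [← h2]
    simp only [add_mul, mul_add, smul_mul_assoc, mul_smul_comm, one_mul, mul_one, smul_sub]
    abel
  rw [← hJ] at h1
  exact hJ0 ((smul_eq_zero.1 h1).resolve_left hd)

theorem smul_one_add_smul_ne_zero_of_anticommute (h2 : (2 : K) ≠ 0) {a b : K}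
    (hI : I * I = a • 1) (ha : a ≠ 0) (hJ : J * J = b • 1) (hb : b ≠ 0) (hIJ : I * J = -(J * I))
    {d : K} (hd : d ≠ 0) (c : K) : c • (1 : Matrix (Fin 2) (Fin 2) K) + d • J ≠ 0 := by
  refine smul_one_add_smul_ne_zero (Z := I) (J := J * I - I * J) rfl ?_ hd c
  intro h
  rw [hIJ, sub_neg_eq_add, ← two_smul K] at h
  have h1 := (smul_eq_zero.1 h).resolve_left h2
  have h3 : J * (J * I) * I = (b * a) • 1 := by
    rw [← mul_assoc J, hJ, smul_mul_assoc, one_mul, smul_mul_assoc, hI, smul_smul]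
  rw [h1, mul_zero, zero_mul] at h3
  exact (smul_ne_zero (mul_ne_zero hb ha) one_ne_zero) h3.symm

theorem smul_one_add_mul_sub {s a : K} (hI : I * I = a • 1) (hs : s ^ 2 = a) :
    (a • 1 + (-s) • I) * (a • 1 + s • I) = 0 := by
  simp only [add_mul, mul_add, smul_mul_assoc, mul_smul_comm, one_mul, mul_one, hI, ← hs]
  module

/-- The norm form of a quaternion algebra on the elements without component of `J`. -/
theorem quaternion_mul {a b : K} (hI : I * I = a • 1) (hJ : J * J = b • 1)
    (hIJ : I * J = -(J * I)) (c d e : K) :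
    (c • 1 + (d • I + e • (I * J))) * (c • 1 - (d • I + e • (I * J))) =
      (c ^ 2 - d ^ 2 * a + e ^ 2 * (a * b)) • 1 := by
  have h1 : I * (I * J) = a • J := by rw [← mul_assoc, hI, smul_mul_assoc, one_mul]
  have h2 : I * J * I = -(a • J) := by
    rw [hIJ, neg_mul, mul_assoc, hI, mul_smul_comm, mul_one]
  have h3 : I * J * (I * J) = -((a * b) • 1) := by
    rw [← mul_assoc, h2, neg_mul, smul_mul_assoc, hJ, smul_smul]
  simp only [add_mul, mul_sub, mul_add, smul_mul_assoc, mul_smul_comm, one_mul, mul_one, h1, h2,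
    h3, hI]
  module

theorem quaternion_ne_zero (h2 : (2 : K) ≠ 0) {a : K} (hI : I * I = a • 1) (ha : a ≠ 0)
    (hIJ : I * J = -(J * I)) (hJ : J = I * Z - Z * I) (hJ0 : J ≠ 0) {d : K} (hd : d ≠ 0)
    (c e : K) : c • 1 + (d • I + e • (I * J)) ≠ 0 := by
  intro h
  -- Conjugation by `I` negates the component of `I * J`.
  have h3 : I * (c • 1 + (d • I + e • (I * J))) * I = a • (c • 1 + (d • I - e • (I * J))) := by
    have h4 : I * (I * J) = a • J := by rw [← mul_assoc, hI, smul_mul_assoc, one_mul]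
    have h5 : J * I = -(I * J) := by rw [hIJ, neg_neg]
    simp only [mul_add, add_mul, mul_smul_comm, smul_mul_assoc, mul_one, h4, hI, one_mul, h5]
    module
  rw [h, mul_zero, zero_mul] at h3
  have h5 := (smul_eq_zero.1 h3.symm).resolve_left ha
  refine smul_one_add_smul_ne_zero hJ hJ0 (mul_ne_zero h2 hd) (2 * c) ?_
  linear_combination (norm := module) h + h5

end Field

section Prime

variable {p : ℕ} [hp : Fact p.Prime] {w : ℕ → ℕ}
  {b : Module.Basis (Fin 4) (ZMod p) (Matrix (Fin 2) (Fin 2) (ZMod p))}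

theorem scalarOf_eq_zero_iff (x : Fin 4 → ℕ) :
    scalarOf w p x = 0 ↔ (scalarOf w p x : ZMod p) = 0 := by
  rw [scalarOf, vmul, md_eq_zero_iff hp.out.ne_zero,
    cast_md hp.out.ne_zero (ZMod.natCast_self p)]

theorem zeroDivisor_spec (hw : IsTable w b) {i j : Fin 4 → ℕ}
    {X Y Z : Matrix (Fin 2) (Fin 2) (ZMod p)} (hi : elt b i = X * Y - Y * X)
    (hj : elt b j = elt b i * Z - Z * elt b i) (hj0 : elt b j ≠ 0) :
    elt b (zeroDivisor w p i j) ≠ 0 ∧ (elt b (zeroDivisor w p i j)).det = 0 := by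
  have hp0 := hp.out.ne_zero
  have hpp := ZMod.natCast_self p
  have hI := sq_eq_smul_one_of_trace_eq_zero (hi ▸ trace_commutator X Y)
  have hJ := sq_eq_smul_one_of_trace_eq_zero (hj ▸ trace_commutator (elt b i) Z)
  have hIJ := hj ▸ anticommute_commutator (Z := Z) hI
  have ha := cast_scalarOf hw ((elt_vmul hw hp0 hpp i i).trans hI)
  have hb := cast_scalarOf hw ((elt_vmul hw hp0 hpp j j).trans hJ)
  have hi0 : elt b i ≠ 0 := fun h => hj0 (by rw [hj, h]; simp)
  unfold zeroDivisor
  dsimp only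
  set a := scalarOf w p (vmul w p i i)
  set c := scalarOf w p (vmul w p j j)
  rw [← ha] at hI
  rw [← hb] at hJ
  by_cases ha0 : a = 0
  · rw [ifz, if_pos ha0]
    rw [ha0, Nat.cast_zero, zero_smul] at hI
    exact ⟨hi0, det_eq_zero_of_mul_eq_zero hI hi0⟩
  rw [ifz, if_neg ha0]
  by_cases hb0 : c = 0
  · rw [ifz, if_pos hb0]
    rw [hb0, Nat.cast_zero, zero_smul] at hJ
    exact ⟨hj0, det_eq_zero_of_mul_eq_zero hJ hj0⟩
  rw [ifz, if_neg hb0]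
  have ha1 : (a : ZMod p) ≠ 0 := mt (scalarOf_eq_zero_iff _).2 ha0
  have hb1 : (c : ZMod p) ≠ 0 := mt (scalarOf_eq_zero_iff _).2 hb0
  have hne {s x : ZMod p} (hs : s ^ 2 = x) (hx : x ≠ 0) : s ≠ 0 := by
    rintro rfl
    exact hx (by rw [← hs]; simp)
  rcases selectRoot_spec ha1 hb1 with ⟨hr, hs⟩ | ⟨hr, hs, h2⟩ | ⟨hr, hs, h2⟩
  · rw [hr, ifz, if_pos rfl, elt_vsub hp0 hpp, elt_vsmul hp0 hpp, elt_vmul hw hp0 hpp, hI,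
      sub_eq_add_neg, ← neg_smul]
    exact ⟨smul_one_add_smul_ne_zero hj hj0 (neg_ne_zero.2 (hne hs ha1)) _,
      det_eq_zero_of_mul_eq_zero (smul_one_add_mul_sub hI hs)
        (smul_one_add_smul_ne_zero hj hj0 (hne hs ha1) _)⟩
  · rw [hr, ifz, if_neg one_ne_zero, ifz, if_pos rfl, elt_vsub hp0 hpp, elt_vsmul hp0 hpp,
      elt_vmul hw hp0 hpp, hJ, sub_eq_add_neg, ← neg_smul]
    have hJne {d : ZMod p} (hd : d ≠ 0) :=
      smul_one_add_smul_ne_zero_of_anticommute h2 hI ha1 hJ hb1 hIJ hd c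
    exact ⟨hJne (neg_ne_zero.2 (hne hs hb1)),
      det_eq_zero_of_mul_eq_zero (smul_one_add_mul_sub hJ hs) (hJne (hne hs hb1))⟩
  · rw [hr, ifz, if_neg two_ne_zero, ifz, if_neg (by decide)]
    simp only [elt_vadd hp0 hpp, elt_vsmul hp0 hpp, elt_vmul hw hp0 hpp, hI, smul_smul,
      Nat.cast_mul]
    have ht := twoSq_spec (p := p) a
    set t := twoSq p a
    set s := (selectRoot p a c).2
    have hs0 : (s : ZMod p) ≠ 0 := hne hs (mul_ne_zero ha1 hb1)
    have hmul := quaternion_mul hI hJ hIJ (t.1 * s * a) (a * s) (a * t.2)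
    -- The norm of the element is `(a s) ^ 2 (t.1 ^ 2 - a + t.2 ^ 2) = 0`, as `a c = s ^ 2`.
    rw [show ((t.1 : ZMod p) * s * a) ^ 2 - (a * s) ^ 2 * a + (a * t.2) ^ 2 * (a * c) = 0 by
      linear_combination (a * s : ZMod p) ^ 2 * ht - (a * t.2 : ZMod p) ^ 2 * hs, zero_smul] at hmul
    refine ⟨quaternion_ne_zero h2 hI ha1 hIJ hj hj0 (mul_ne_zero ha1 hs0) _ _,
      det_eq_zero_of_mul_eq_zero hmul ?_⟩
    have := quaternion_ne_zero h2 hI ha1 hIJ hj hj0 (neg_ne_zero.2 (mul_ne_zero ha1 hs0))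
      (t.1 * s * a : ZMod p) (-(a * t.2))
    rwa [neg_smul, neg_smul, ← neg_add, ← sub_eq_add_neg] at this

theorem idempotentOf_spec (hw : IsTable w b) {z : Fin 4 → ℕ} (hz0 : elt b z ≠ 0)
    (hz : (elt b z).det = 0) :
    IsIdempotentElem (elt b (idempotentOf w p z)) ∧ elt b (idempotentOf w p z) ≠ 0 ∧
      (elt b (idempotentOf w p z)).det = 0 := by
  have hp0 := hp.out.ne_zero
  have hpp := ZMod.natCast_self p
  have hzbz (m : Fin 4) : elt b (vmul w p (vmul w p z (bvec m)) z) =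
      (elt b z * b m).trace • elt b z := by
    rw [elt_vmul hw hp0 hpp, elt_vmul hw hp0 hpp, elt_bvec, mul_mul_eq_trace_smul hz]
  have hcast (m l : Fin 4) : (vmul w p (vmul w p z (bvec m)) z l : ZMod p) =
      (elt b z * b m).trace * z l := by
    rw [← repr_elt b, hzbz, map_smul, Finsupp.smul_apply, repr_elt, smul_eq_mul]
  have hiff (m l : Fin 4) : vmul w p (vmul w p z (bvec m)) z l = 0 ↔
      (vmul w p (vmul w p z (bvec m)) z l : ZMod p) = 0 := by
    rw [vmul, md_eq_zero_iff hp0, cast_md hp0 hpp]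
  -- The trace form is nondegenerate, so `z * b m` has nonzero trace for some `m`.
  obtain ⟨m, hm⟩ : ∃ m, (elt b z * b m).trace ≠ 0 := by
    by_contra! h
    have h1 : ∀ X, (elt b z * X).trace = 0 := basis_induction b (by simp)
      (fun x y hx hy => by rw [mul_add, trace_add, hx, hy, add_zero])
      (fun r x hx => by rw [mul_smul_comm, trace_smul, hx, smul_zero]) h
    refine hz0 (Matrix.ext fun i j => ?_)
    simpa [Matrix.trace_mul_single] using h1 (Matrix.single j i 1)
  obtain ⟨l, hl⟩ : ∃ l, (z l : ZMod p) ≠ 0 := by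
    by_contra! h
    exact hz0 (by simp [elt, h])
  obtain ⟨⟨m, l⟩, h1, h2⟩ := search_spec (ι := Fin 4 × Fin 4) (d := 0)
    (L := Finset.univ.toList)
    (test := fun m => vmul w p (vmul w p z (bvec m.1)) z m.2)
    (f := fun m => vsmul p (z m.2 * powMod p (vmul w p (vmul w p z (bvec m.1)) z m.2) (p - 2))
      (vmul w p z (bvec m.1)))
    ⟨(m, l), by simp, by rw [Ne, hiff, hcast]; exact mul_ne_zero hm hl⟩
  rw [Ne, hiff] at h1
  dsimp only at h1
  rw [idempotentOf]
  dsimp only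
  rw [h2, elt_vsmul hp0 hpp, elt_vmul hw hp0 hpp, elt_bvec, Nat.cast_mul, cast_powMod hp0 hpp,
    pow_sub_two_eq_inv h1]
  rw [hcast] at h1 ⊢
  have hZ := mul_mul_eq_trace_smul hz (b m)
  have ht := left_ne_zero_of_mul h1
  have hzl := right_ne_zero_of_mul h1
  generalize (elt b z * b m).trace = t at *
  rw [show (z l : ZMod p) * (t * z l)⁻¹ = t⁻¹ by field_simp]
  refine ⟨?_, fun h => ?_, ?_⟩
  · rw [IsIdempotentElem, smul_mul_smul_comm, ← mul_assoc, hZ, smul_mul_assoc, smul_smul,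
      mul_assoc, inv_mul_cancel₀ ht, mul_one]
  · rw [(smul_eq_zero.1 h).resolve_left (inv_ne_zero ht), zero_mul] at hZ
    exact (smul_ne_zero ht hz0) hZ.symm
  · rw [det_smul, det_mul, hz, zero_mul, mul_zero]

end Prime

/-! ### Matrix units from an idempotent -/

section Units

variable {R : Type*} [CommRing R] {E u v x y : Matrix (Fin 2) (Fin 2) R}

/-- If `u = E x (1 - E)` and `v = (1 - E) y E` satisfy `u v = E` for an idempotent `E` of rank one,
then `E`, `u`, `v`, `v u` are matrix units. -/
theorem mul_eq_one_sub_of_mul_eq (hE : IsIdempotentElem E) (hdet : E.det = 0) (htr : E.trace = 1)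
    (hu : u = E * x * (1 - E)) (hv : v = (1 - E) * y * E) (huv : u * v = E) : v * u = 1 - E := by
  have hF := hE.one_sub
  have hFdet : (1 - E).det = 0 := by
    rw [det_fin_two] at hdet ⊢
    rw [trace_fin_two] at htr
    simp
    linear_combination hdet - htr
  have h1 : v * u = (1 - E) * (y * E * x) * (1 - E) := by
    rw [hv, hu, show (1 - E) * y * E * (E * x * (1 - E)) = (1 - E) * y * (E * E) * x * (1 - E) by
      noncomm_ring, hE.eq]
    noncomm_ring
  rw [h1, mul_mul_eq_trace_smul hFdet]
  have h2 : ((1 - E) * (y * E * x)).trace = (v * u).trace := by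
    rw [h1, trace_mul_comm, ← hF.eq, ← mul_assoc, trace_mul_comm, hF.eq, ← mul_assoc]
  rw [h2, trace_mul_comm, huv, htr, one_smul]

/-- The change of basis to the matrix units `Y s * X t`, where `X = (E, u)` and `Y = (E, v)`. -/
theorem exists_algHom_trace (hE : IsIdempotentElem E) (hdet : E.det = 0) (htr : E.trace = 1)
    (hu : u = E * x * (1 - E)) (hv : v = (1 - E) * y * E) (huv : u * v = E) :
    ∃ θ : Matrix (Fin 2) (Fin 2) R →ₐ[R] Matrix (Fin 2) (Fin 2) R, Function.Injective θ ∧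
      ∀ a s t, ![E, u] s * a * ![E, v] t = θ a s t • E := by
  have hvu := mul_eq_one_sub_of_mul_eq hE hdet htr hu hv huv
  have hF : (1 - E) * E = 0 := by rw [sub_mul, one_mul, hE.eq, sub_self]
  have hF' : E * (1 - E) = 0 := by rw [mul_sub, mul_one, hE.eq, sub_self]
  have hX (s) : E * ![E, u] s = ![E, u] s := by
    fin_cases s
    · exact hE
    · simp [hu, ← mul_assoc, hE.eq]
  have hY (t) : ![E, v] t * E = ![E, v] t := by
    fin_cases t
    · exact hE
    · simp [hv, mul_assoc, hE.eq]
  have hXY (s t) : ![E, u] s * ![E, v] t = if s = t then E else 0 := by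
    fin_cases s <;> fin_cases t
    · exact hE
    · simp [hv, ← mul_assoc, hF']
    · simp [hu, mul_assoc, hF]
    · simpa using huv
  have hYX : ∑ t, ![E, v] t * ![E, u] t = 1 := by
    simp [Fin.sum_univ_two, hE.eq, hvu]
  generalize ![E, u] = X at *
  generalize ![E, v] = Y at *
  have hθ (a s t) : X s * a * Y t = (X s * a * Y t).trace • E := by
    have h1 : E * (X s * a * Y t) = X s * a * Y t := by
      rw [← mul_assoc, ← mul_assoc, hX]
    have h2 := mul_mul_eq_trace_smul hdet (X s * a * Y t)
    rwa [h1, mul_assoc, hY] at h2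
  let f : Matrix (Fin 2) (Fin 2) R →ₗ[R] Matrix (Fin 2) (Fin 2) R :=
    { toFun := fun a => Matrix.of fun s t => (X s * a * Y t).trace
      map_add' := fun a b => by ext s t; simp [mul_add, add_mul]
      map_smul' := fun r a => by ext s t; simp }
  have hf (a s t) : f a s t = (X s * a * Y t).trace := rfl
  refine ⟨AlgHom.ofLinearMap f ?_ ?_, ?_, ?_⟩
  · ext s t
    rw [hf, mul_one, hXY, Matrix.one_apply]
    split <;> simp [htr]
  · intro a b
    ext s t
    have h1 : X s * (a * b) * Y t = ∑ r, (X s * a * Y r) * (X r * b * Y t) := by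
      calc X s * (a * b) * Y t = X s * a * (∑ r, Y r * X r) * (b * Y t) := by
            rw [hYX]; noncomm_ring
        _ = _ := by
            rw [Finset.mul_sum, Finset.sum_mul]
            exact Finset.sum_congr rfl fun r _ => by noncomm_ring
    rw [hf, h1, trace_sum, Matrix.mul_apply]
    refine Finset.sum_congr rfl fun r _ => ?_
    rw [hθ a s r, hθ b r t, smul_mul_smul_comm, hE.eq, trace_smul, htr, smul_eq_mul, mul_one, hf,
      hf]
  · rw [injective_iff_map_eq_zero]
    intro a ha
    have h0 (s t) : X s * a * Y t = 0 := by
      rw [hθ, ← hf, show f a = 0 from ha]; simp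
    calc a = (∑ s, Y s * X s) * a * ∑ t, Y t * X t := by rw [hYX, one_mul, mul_one]
      _ = ∑ s, ∑ t, Y s * (X s * a * Y t) * X t := by
          simp only [Finset.sum_mul, Finset.mul_sum, mul_assoc]
          rw [Finset.sum_comm]
      _ = 0 := by simp [h0]
  · exact fun a s t => hθ a s t

end Units

/-! ### Correctness modulo a prime power -/

section PrimePower

variable {p k : ℕ} [hp : Fact p.Prime]

theorem isUnit_natCast_prime_pow (hk : k ≠ 0) {x : ℕ} :
    IsUnit (x : ZMod (p ^ k)) ↔ (x : ZMod p) ≠ 0 := by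
  rw [ZMod.isUnit_iff_coprime, Nat.coprime_pow_right_iff (Nat.pos_of_ne_zero hk), Ne,
    ZMod.natCast_eq_zero_iff, Nat.coprime_comm, hp.out.coprime_iff_not_dvd]

theorem totient_eq (hk : k ≠ 0) : p ^ k / p * (p - 1) = Nat.totient (p ^ k) := by
  obtain ⟨k, rfl⟩ := Nat.exists_eq_succ_of_ne_zero hk
  rw [Nat.totient_prime_pow_succ hp.out, Nat.succ_eq_add_one, pow_succ,
    Nat.mul_div_cancel _ hp.out.pos]

theorem cast_invMod_mul (hk : k ≠ 0) {x : ℕ} (hx : IsUnit (x : ZMod (p ^ k))) :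
    (invMod p (p ^ k) x : ZMod (p ^ k)) * x = 1 := by
  have hQ : p ^ k ≠ 0 := pow_ne_zero _ hp.out.ne_zero
  rw [invMod, cast_powMod hQ (ZMod.natCast_self _), totient_eq hk, ← pow_succ,
    Nat.sub_add_cancel (Nat.totient_pos.2 (Nat.pos_of_ne_zero hQ))]
  obtain ⟨u, hu⟩ := hx
  rw [← hu, ← Units.val_pow_eq_pow_val, ZMod.pow_totient, Units.val_one]

theorem exists_eq_mul_of_castHom_eq_zero (hd : p ∣ p ^ k) {x : ZMod (p ^ k)}
    (hx : ZMod.castHom hd (ZMod p) x = 0) : ∃ y, x = p * y := by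
  have : NeZero (p ^ k) := ⟨pow_ne_zero _ hp.out.ne_zero⟩
  rw [← ZMod.natCast_zmod_val x, map_natCast, ZMod.natCast_eq_zero_iff] at hx
  obtain ⟨y, hy⟩ := hx
  exact ⟨y, by rw [← ZMod.natCast_zmod_val x, hy, Nat.cast_mul]⟩

variable {w : ℕ → ℕ} {b : Module.Basis (Fin 4) (ZMod p) (Matrix (Fin 2) (Fin 2) (ZMod p))}
  {c : Module.Basis (Fin 4) (ZMod (p ^ k)) (Matrix (Fin 2) (Fin 2) (ZMod (p ^ k)))}

theorem map_elt {R S : Type*} [CommRing R] [CommRing S] (f : R →+* S)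
    {b : Fin 4 → Matrix (Fin 2) (Fin 2) S} {c : Fin 4 → Matrix (Fin 2) (Fin 2) R}
    (hbc : ∀ i, b i = (c i).map f) (x : Fin 4 → ℕ) : (elt c x).map f = elt b x := by
  ext s t
  simp [elt, hbc, Matrix.sum_apply]

theorem elt_md {R : Type*} [CommRing R] {M : ℕ} (hM : M ≠ 0) (hR : (M : R) = 0)
    (b : Fin 4 → Matrix (Fin 2) (Fin 2) R) (x : Fin 4 → ℕ) :
    elt b (fun i => md (x i) M) = elt b x := by
  simp only [elt, cast_md hM hR]

theorem elt_liftStep {R : Type*} [CommRing R] {M : ℕ} (hM : M ≠ 0) (hR : (M : R) = 0)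
    {b : Fin 4 → Matrix (Fin 2) (Fin 2) R} (hw : IsTable w b) (e : Fin 4 → ℕ) :
    elt b (liftStep w M e) = 3 * (elt b e * elt b e) - 2 * (elt b e * (elt b e * elt b e)) := by
  simp only [liftStep, elt_vsub hM hR, elt_vsmul hM hR, elt_vmul hw hM hR, Nat.cast_ofNat,
    ofNat_smul_eq_nsmul, nsmul_eq_mul]

theorem elt_liftIdempotent (hk : k ≠ 0) (hw : IsTable w b) {e : Fin 4 → ℕ}
    (he : IsIdempotentElem (elt b e)) : elt b (liftIdempotent w (p ^ k) e) = elt b e := by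
  have hQ : p ^ k ≠ 0 := pow_ne_zero _ hp.out.ne_zero
  have hR : ((p ^ k : ℕ) : ZMod p) = 0 := by simp [hk]
  rw [liftIdempotent]
  induction (p ^ k).size with
  | zero => rw [Function.iterate_zero_apply, elt_md hQ hR]
  | succ n ih =>
    rw [Function.iterate_succ_apply', elt_liftStep hQ hR hw, ih, he.eq, he.eq]
    noncomm_ring

/-- With `d = e ^ 2 - e`, a Newton step turns `d` into `d ^ 2 (4 d - 3)`; hence `d` is divisible by
`p ^ (n + 1)` after `n` steps. The convergence is in fact quadratic, which is not needed, as
`k ≤ size (p ^ k)`. -/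
theorem isIdempotentElem_liftIdempotent (hd : p ∣ p ^ k)
    (hbc : ∀ i, b i = (c i).map (ZMod.castHom hd (ZMod p))) (hw : IsTable w c) {e : Fin 4 → ℕ}
    (he : IsIdempotentElem (elt b e)) :
    IsIdempotentElem (elt c (liftIdempotent w (p ^ k) e)) := by
  have hQ : p ^ k ≠ 0 := pow_ne_zero _ hp.out.ne_zero
  have hR := ZMod.natCast_self (p ^ k)
  have h : ∀ n, ∃ X, elt c ((liftStep w (p ^ k))^[n] fun i => md (e i) (p ^ k)) *
      elt c ((liftStep w (p ^ k))^[n] fun i => md (e i) (p ^ k)) -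
      elt c ((liftStep w (p ^ k))^[n] fun i => md (e i) (p ^ k)) =
        (p : ZMod (p ^ k)) ^ (n + 1) • X := by
    intro n
    induction n with
    | zero =>
      rw [Function.iterate_zero_apply, elt_md hQ hR]
      have h1 : (elt c e * elt c e - elt c e).map (ZMod.castHom hd (ZMod p)) = 0 := by
        rw [Matrix.map_sub _ (map_sub _), Matrix.map_mul, map_elt _ hbc, he.eq, sub_self]
      choose X hX using fun s t =>
        exists_eq_mul_of_castHom_eq_zero hd (congrFun (congrFun h1 s) t)
      exact ⟨Matrix.of X, Matrix.ext fun s t => by simpa using hX s t⟩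
    | succ n ih =>
      obtain ⟨X, hX⟩ := ih
      rw [Function.iterate_succ_apply', elt_liftStep hQ hR hw]
      set E := elt c ((liftStep w (p ^ k))^[n] fun i => md (e i) (p ^ k))
      refine ⟨(p : ZMod (p ^ k)) ^ n • (X * X * (4 * (E * E - E) - 3)), ?_⟩
      have h1 : (3 * (E * E) - 2 * (E * (E * E))) * (3 * (E * E) - 2 * (E * (E * E))) -
          (3 * (E * E) - 2 * (E * (E * E))) =
            (E * E - E) * (E * E - E) * (4 * (E * E - E) - 3) := by noncomm_ring
      rw [h1]
      generalize 4 * (E * E - E) - 3 = Y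
      rw [hX, smul_mul_smul_comm, smul_mul_assoc, smul_smul]
      congr 1
      ring
  obtain ⟨X, hX⟩ := h (p ^ k).size
  rw [IsIdempotentElem, ← sub_eq_zero, liftIdempotent, hX]
  have hle : k ≤ (p ^ k).size + 1 := by
    have h1 := Nat.pow_le_pow_left hp.out.two_le k
    have h2 : k < (p ^ k).size := Nat.lt_size.2 h1
    omega
  rw [← Nat.add_sub_of_le hle, pow_add, ← Nat.cast_pow, hR, zero_mul, zero_smul]

theorem det_eq_zero_of_isIdempotentElem (hk : k ≠ 0) (hd : p ∣ p ^ k)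
    {E : Matrix (Fin 2) (Fin 2) (ZMod (p ^ k))} (hE : IsIdempotentElem E)
    (h0 : (E.map (ZMod.castHom hd (ZMod p))).det = 0) : E.det = 0 := by
  have hdet : IsIdempotentElem E.det := by rw [IsIdempotentElem, ← det_mul, hE.eq]
  have h1 : ZMod.castHom hd (ZMod p) E.det = 0 := by
    rw [RingHom.map_det]; exact h0
  obtain ⟨y, hy⟩ := exists_eq_mul_of_castHom_eq_zero hd h1
  obtain ⟨n, rfl⟩ := Nat.exists_eq_succ_of_ne_zero hk
  rw [← hdet.pow_succ_eq n, hy, mul_pow, ← Nat.cast_pow]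
  simp

/-- An idempotent of rank one has a nonzero product `(E b i (1 - E)) ((1 - E) b j E)`, since matrix
algebras over fields are prime. -/
theorem exists_mul_compl_mul_ne_zero {K ι : Type*} [Field K] [Finite ι]
    (b : Module.Basis ι K (Matrix (Fin 2) (Fin 2) K)) {E : Matrix (Fin 2) (Fin 2) K}
    (h0 : E ≠ 0) (hdet : E.det = 0) : ∃ i j, E * b i * (1 - E) * (b j * E) ≠ 0 := by
  by_contra! h
  have h1 : ∀ Y i, E * b i * (1 - E) * (Y * E) = 0 := fun Y i =>
    basis_induction b (P := fun Y => E * b i * (1 - E) * (Y * E) = 0) (by simp)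
      (fun x y hx hy => by rw [add_mul, mul_add, hx, hy, add_zero])
      (fun r x hx => by rw [smul_mul_assoc, mul_smul_comm, hx, smul_zero]) (h i) Y
  have h2 : ∀ X Y, E * X * (1 - E) * (Y * E) = 0 := fun X Y =>
    basis_induction b (P := fun X => E * X * (1 - E) * (Y * E) = 0) (by simp)
      (fun x y hx hy => by rw [mul_add, add_mul, add_mul, hx, hy, add_zero])
      (fun r x hx => by rw [mul_smul_comm, smul_mul_assoc, smul_mul_assoc, hx, smul_zero])
      (h1 Y) X
  have h3 : ∀ Y, (1 - E) * Y * E = 0 := fun Y =>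
    (eq_zero_or_eq_zero_of_forall_mul fun X => by
      rw [← h2 X Y]; simp only [mul_assoc]).resolve_left h0
  rcases eq_zero_or_eq_zero_of_forall_mul h3 with h4 | h4
  · rw [← sub_eq_zero.1 h4, det_one] at hdet
    exact one_ne_zero hdet
  · exact h0 h4

theorem IsTable.map {R S : Type*} [CommRing R] [CommRing S] (f : R →+* S)
    {b : Fin 4 → Matrix (Fin 2) (Fin 2) S} {c : Fin 4 → Matrix (Fin 2) (Fin 2) R}
    (hwc : IsTable w c) (hbc : ∀ i, b i = (c i).map f) : IsTable w b := fun i j => by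
  rw [hbc, hbc, ← Matrix.map_mul, hwc i j]
  ext s t
  simp [hbc, Matrix.sum_apply]

theorem elt_ifz {R : Type*} [CommRing R] (b : Fin 4 → Matrix (Fin 2) (Fin 2) R)
    (s : Fin 2) (x y : Fin 4 → ℕ) : elt b (ifz s x y) = ![elt b x, elt b y] s := by
  fin_cases s <;> rfl

theorem localMatrices_spec (hk : k ≠ 0) (hd : p ∣ p ^ k)
    (hbc : ∀ i, b i = (c i).map (ZMod.castHom hd (ZMod p))) (hwb : IsTable w b)
    (hwc : IsTable w c) {e : Fin 4 → ℕ} (he : IsIdempotentElem (elt c e)) (he0 : elt b e ≠ 0)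
    (hedet : (elt b e).det = 0) :
    ∃ θ : Matrix (Fin 2) (Fin 2) (ZMod (p ^ k)) →ₐ[ZMod (p ^ k)]
        Matrix (Fin 2) (Fin 2) (ZMod (p ^ k)), Function.Injective θ ∧
      ∀ r s t, (localMatrices w p (p ^ k) e r s t : ZMod (p ^ k)) = θ (c r) s t := by
  have hp0 := hp.out.ne_zero
  have hQ : p ^ k ≠ 0 := pow_ne_zero _ hp0
  have hQp : ((p ^ k : ℕ) : ZMod p) = 0 := by simp [hk]
  have hQQ := ZMod.natCast_self (p ^ k)
  have hyb (i j) : elt b (corner w (p ^ k) e i j) =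
      elt b e * b i * (1 - elt b e) * (b j * elt b e) := by
    simp only [corner, elt_vsub hQ hQp, elt_vmul hwb hQ hQp, elt_bvec]
    noncomm_ring
  have hyc (i j) : elt c (corner w (p ^ k) e i j) =
      elt c e * c i * (1 - elt c e) * (c j * elt c e) := by
    simp only [corner, elt_vsub hQ hQQ, elt_vmul hwc hQ hQQ, elt_bvec]
    noncomm_ring
  obtain ⟨i, j, hij⟩ := exists_mul_compl_mul_ne_zero b he0 hedet
  obtain ⟨l, hl⟩ : ∃ l, (corner w (p ^ k) e i j l : ZMod p) ≠ 0 := by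
    by_contra! h
    rw [← hyb] at hij
    exact hij (Finset.sum_eq_zero fun l _ => by rw [h l, zero_smul])
  obtain ⟨m, h1, h2⟩ := search_spec (L := Finset.univ.toList) (d := 0)
    (test := fun m : Fin 4 × Fin 4 × Fin 4 => md (corner w (p ^ k) e m.1 m.2.1 m.2.2) p)
    (f := matricesOfCorner w p (p ^ k) e)
    ⟨(i, j, l), by simp, by rw [Ne, md_eq_zero_iff hp0]; exact hl⟩
  rw [Ne, md_eq_zero_iff hp0] at h1
  rw [localMatrices, h2]
  clear h2 hij hl i j l
  unfold matricesOfCorner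
  obtain ⟨i, j, l⟩ := m
  dsimp only at h1 ⊢
  generalize corner w (p ^ k) e = y at *
  have hdet : (elt c e).det = 0 :=
    det_eq_zero_of_isIdempotentElem hk hd he (by rw [map_elt _ hbc]; exact hedet)
  -- The coordinate `y i j l` is a unit and a multiple of `e l`.
  have hyu := (isUnit_natCast_prime_pow hk).2 h1
  set x := c i * (1 - elt c e) * c j with hx
  have hyx : elt c (y i j) = (elt c e * x).trace • elt c e := by
    rw [← mul_mul_eq_trace_smul hdet, hyc]; simp only [hx, mul_assoc]
  have hyl : (y i j l : ZMod (p ^ k)) = (elt c e * x).trace * e l := by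
    rw [← repr_elt c, hyx, map_smul, Finsupp.smul_apply, repr_elt, smul_eq_mul]
  have hel : IsUnit (e l : ZMod (p ^ k)) := isUnit_of_mul_isUnit_right (hyl ▸ hyu)
  have htr : (elt c e).trace = 1 := by
    have h3 := mul_mul_eq_trace_smul hdet 1
    rw [mul_one, he.eq] at h3
    have h4 := congrArg (fun z => c.repr z l) h3
    simp only [map_smul, Finsupp.smul_apply, repr_elt, smul_eq_mul] at h4
    exact hel.mul_right_cancel (by rw [one_mul]; exact h4.symm)
  set u := vsub (p ^ k) (vmul w (p ^ k) e (bvec i))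
    (vmul w (p ^ k) (vmul w (p ^ k) e (bvec i)) e) with hu
  set v := vsmul (p ^ k) (e l * invMod p (p ^ k) (y i j l))
    (vsub (p ^ k) (vmul w (p ^ k) (bvec j) e) (vmul w (p ^ k) e (vmul w (p ^ k) (bvec j) e)))
    with hv
  have hu' : elt c u = elt c e * c i * (1 - elt c e) := by
    simp only [hu, elt_vsub hQ hQQ, elt_vmul hwc hQ hQQ, elt_bvec, mul_sub, mul_one]
  have hv' : elt c v = (1 - elt c e) *
      (((e l * invMod p (p ^ k) (y i j l) : ℕ) : ZMod (p ^ k)) • c j) * elt c e := by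
    simp only [hv, elt_vsmul hQ hQQ, elt_vsub hQ hQQ, elt_vmul hwc hQ hQQ, elt_bvec, sub_mul,
      one_mul, mul_smul_comm, smul_mul_assoc, smul_sub, mul_assoc]
  have huv : elt c u * elt c v = elt c e := by
    have h3 : elt c e * c i * (1 - elt c e) * ((1 - elt c e) * c j * elt c e) =
        elt c (y i j) := by
      rw [hyc, ← mul_assoc, ← mul_assoc (elt c e * c i * (1 - elt c e)), mul_assoc (elt c e * c i),
        he.one_sub.eq, mul_assoc]
    rw [hu', hv', mul_smul_comm, smul_mul_assoc, mul_smul_comm, h3, hyx, smul_smul]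
    rw [show ((e l * invMod p (p ^ k) (y i j l) : ℕ) : ZMod (p ^ k)) * (elt c e * x).trace = 1 by
      rw [← cast_invMod_mul hk hyu, hyl]; push_cast; ring, one_smul]
  obtain ⟨θ, hθ, hθ'⟩ := exists_algHom_trace he hdet htr hu' hv' huv
  refine ⟨θ, hθ, fun r s t => ?_⟩
  rw [cast_md hQ hQQ, Nat.cast_mul, ← repr_elt c, elt_vmul hwc hQ hQQ, elt_vmul hwc hQ hQQ,
    elt_bvec, elt_ifz, elt_ifz, hθ', map_smul, Finsupp.smul_apply, repr_elt, smul_eq_mul, mul_assoc,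
    mul_comm (e l : ZMod (p ^ k)), cast_invMod_mul hk hel, mul_one]

/-- The matrices computed modulo a prime power are those of an algebra embedding. -/
theorem exists_localSplitting {Q : ℕ} (hQ : Q = p ^ k) (hk : k ≠ 0) (hd : p ∣ Q)
    {c : Module.Basis (Fin 4) (ZMod Q) (Matrix (Fin 2) (Fin 2) (ZMod Q))}
    (hbc : ∀ i, b i = (c i).map (ZMod.castHom hd (ZMod p))) (hwc : IsTable w c) :
    ∃ θ : Matrix (Fin 2) (Fin 2) (ZMod Q) →ₐ[ZMod Q] Matrix (Fin 2) (Fin 2) (ZMod Q),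
      Function.Injective θ ∧ ∀ r s t, (localMatrices w p Q (liftIdempotent w Q (idempotentOf w p
        (zeroDivisor w p (anticommPair w p).1 (anticommPair w p).2))) r s t : ZMod Q) =
          θ (c r) s t := by
  subst hQ
  have hwb : IsTable w b := hwc.map _ hbc
  obtain ⟨X, Y, Z, h1, h2, h3⟩ := anticommPair_spec hwb
  obtain ⟨h4, h5⟩ := zeroDivisor_spec hwb h1 h2 h3
  obtain ⟨h6, h7, h8⟩ := idempotentOf_spec hwb h4 h5
  exact localMatrices_spec hk hd hbc hwb hwc (isIdempotentElem_liftIdempotent hd hbc hwc h6)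
    (by rwa [elt_liftIdempotent hk hwb h6]) (by rwa [elt_liftIdempotent hk hwb h6])

end PrimePower

/-! ### Reading the input -/

section Input

variable {N : ℕ} (c : Fin 4 → Fin 4 → Fin 4 → ZMod N) (F : List (ℕ × ℕ))

theorem getD_flatMap_pair (m : ℕ) :
    (F.flatMap fun f => [f.1, f.2]).getD (2 * m) 0 = (F.getD m 0).1 ∧
      (F.flatMap fun f => [f.1, f.2]).getD (2 * m + 1) 0 = (F.getD m 0).2 := by
  induction F generalizing m with
  | nil => simp
  | cons f F ih =>
    cases m with
    | zero => simp
    | succ m => simpa [Nat.mul_succ] using ih m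

theorem readInput_zero : readInput (fun i => (encodeInput N c F).getD i 0) 0 = N := rfl

theorem structConst_encodeInput (i j k : Fin 4) :
    structConst (fun i => (encodeInput N c F).getD i 0) i j k = (c i j k).val := by
  fin_cases i <;> fin_cases j <;> fin_cases k <;> rfl

theorem readInput_factor (m : ℕ) :
    readInput (fun i => (encodeInput N c F).getD i 0) (65 + 2 * m) = (F.getD m 0).1 ∧
      readInput (fun i => (encodeInput N c F).getD i 0) (66 + 2 * m) = (F.getD m 0).2 := by
  have h (n : ℕ) : (encodeInput N c F).getD (65 + n) 0 =
      (F.flatMap fun f => [f.1, f.2]).getD n 0 := by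
    rw [encodeInput, Nat.add_comm 65 n]
    rfl
  have h1 := getD_flatMap_pair F m
  rw [← h, ← h] at h1
  rw [← h1.1, ← h1.2, readInput, readInput, show 65 + (2 * m + 1) = 66 + 2 * m by ring]
  exact ⟨rfl, rfl⟩

end Input

/-! ### The Chinese remainder theorem -/

section Chinese

variable {N : ℕ} {F : List (ℕ × ℕ)}

/-- The prime power at position `m` of the factorization. -/
def primePower (F : List (ℕ × ℕ)) (m : Fin F.length) : ℕ := F[m].1 ^ F[m].2

theorem prod_primePower (hF : IsPrimeFactorization N F) : ∏ m, primePower F m = N := by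
  rw [← hF.2.2, ← Fin.prod_univ_fun_getElem]
  rfl

theorem primePower_pos (hF : IsPrimeFactorization N F) (m : Fin F.length) : 0 < primePower F m :=
  Nat.pow_pos (hF.1 _ (F.getElem_mem m.2)).1.pos

theorem coprime_primePower (hF : IsPrimeFactorization N F) {m n : Fin F.length} (h : m ≠ n) :
    (primePower F m).Coprime (primePower F n) := by
  refine Nat.Coprime.pow _ _ ((Nat.coprime_primes (hF.1 _ (F.getElem_mem m.2)).1
    (hF.1 _ (F.getElem_mem n.2)).1).2 fun he => h (Fin.ext ?_))
  refine (hF.2.1.getElem_inj_iff (hi := by simp) (hj := by simp)).1 ?_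
  simpa using he

theorem primePower_dvd (hF : IsPrimeFactorization N F) (m : Fin F.length) : primePower F m ∣ N :=
  prod_primePower hF ▸ Finset.dvd_prod_of_mem _ (Finset.mem_univ m)

theorem pos_of_isPrimeFactorization (hF : IsPrimeFactorization N F) : 0 < N :=
  prod_primePower hF ▸ Finset.prod_pos fun m _ => primePower_pos hF m

/-- The factorization has at most as many factors as `N` has bits, so that the algorithm may run
through it without knowing its length. -/
theorem two_pow_length_le (hF : IsPrimeFactorization N F) : 2 ^ F.length ≤ N := by
  rw [← prod_primePower hF]
  calc 2 ^ F.length = ∏ _m : Fin F.length, 2 := by simp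
    _ ≤ _ := Finset.prod_le_prod' fun m _ => ?_
  have h := hF.1 _ (F.getElem_mem m.2)
  exact h.1.two_le.trans (Nat.le_self_pow (Nat.one_le_iff_ne_zero.1 h.2) _)

theorem div_primePower (hF : IsPrimeFactorization N F) (m : Fin F.length) :
    N / primePower F m = ∏ n ∈ Finset.univ.erase m, primePower F n := by
  rw [← prod_primePower hF, ← Finset.mul_prod_erase _ _ (Finset.mem_univ m),
    Nat.mul_div_cancel_left _ (primePower_pos hF m)]

/-- The powers of the cofactors are the idempotents of the decomposition of `ℤ/N`. -/
theorem cofactor_pow_totient (hF : IsPrimeFactorization N F) (m n : Fin F.length) :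
    ((N / primePower F m : ℕ) : ZMod (primePower F n)) ^ (primePower F m).totient =
      if n = m then 1 else 0 := by
  rw [div_primePower hF]
  split_ifs with h
  · subst h
    rw [← Nat.cast_pow, ← Nat.cast_one, ZMod.natCast_eq_natCast_iff]
    exact Nat.ModEq.pow_totient (Nat.Coprime.prod_left fun i hi =>
      coprime_primePower hF (Finset.ne_of_mem_erase hi))
  · rw [(ZMod.natCast_eq_zero_iff _ _).2, zero_pow]
    · exact (Nat.totient_pos.2 (primePower_pos hF m)).ne'
    · exact Finset.dvd_prod_of_mem _ (Finset.mem_erase.2 ⟨h, Finset.mem_univ n⟩)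

theorem eq_of_forall_castHom_eq (hF : IsPrimeFactorization N F) {x y : ZMod N}
    (h : ∀ m, ZMod.castHom (primePower_dvd hF m) (ZMod (primePower F m)) x =
      ZMod.castHom (primePower_dvd hF m) (ZMod (primePower F m)) y) : x = y := by
  have : NeZero N := ⟨(pos_of_isPrimeFactorization hF).ne'⟩
  rw [← sub_eq_zero, ← ZMod.natCast_zmod_val (x - y), ZMod.natCast_eq_zero_iff]
  conv_lhs => rw [← prod_primePower hF]
  refine Finset.prod_dvd_of_isRelPrime (fun m _ n _ hmn => ?_) fun m _ => ?_
  · exact Nat.coprime_iff_isRelPrime.1 (coprime_primePower hF hmn)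
  · rw [← ZMod.natCast_eq_zero_iff, ← map_natCast (ZMod.castHom (primePower_dvd hF m) _),
      ZMod.natCast_zmod_val, map_sub, h m, sub_self]

theorem matrix_eq_of_forall_map_eq (hF : IsPrimeFactorization N F)
    {X Y : Matrix (Fin 2) (Fin 2) (ZMod N)}
    (h : ∀ m, X.map (ZMod.castHom (primePower_dvd hF m) (ZMod (primePower F m))) =
      Y.map (ZMod.castHom (primePower_dvd hF m) (ZMod (primePower F m)))) : X = Y :=
  Matrix.ext fun s t => eq_of_forall_castHom_eq hF fun m => congrFun (congrFun (h m) s) t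

/-- The matrices computed for the prime power at position `m`. -/
noncomputable def factorMatrices (w : ℕ → ℕ) (F : List (ℕ × ℕ)) (m : Fin F.length) :
    Fin 4 → Fin 2 → Fin 2 → ℕ :=
  localMatrices w F[m].1 (primePower F m) (liftIdempotent w (primePower F m)
    (idempotentOf w F[m].1 (zeroDivisor w F[m].1 (anticommPair w F[m].1).1
      (anticommPair w F[m].1).2)))

/-- After `n` rounds the sum of the contributions of the first `n` prime powers is known. Rounds
after the end of the factorization change nothing. -/
theorem iterate_mainStep (hF : IsPrimeFactorization N F) (c : Fin 4 → Fin 4 → Fin 4 → ZMod N)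
    (n : ℕ) :
    let w := fun i => (encodeInput N c F).getD i 0
    let y := (mainStep w)^[n] (0, 0)
    y.1 = min n F.length ∧ ∀ (m : Fin F.length) r s t,
      (y.2 r s t : ZMod (primePower F m)) = if m < n then (factorMatrices w F m r s t : ZMod _)
        else 0 := by
  intro w
  induction n with
  | zero => simp
  | succ n ih =>
    obtain ⟨h1, h2⟩ := ih
    rw [Function.iterate_succ_apply']
    set y := (mainStep w)^[n] (0, 0)
    have hN := pos_of_isPrimeFactorization hF
    obtain ⟨hq, hk⟩ := readInput_factor c F y.1
    rw [mainStep]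
    dsimp only
    rw [readInput_zero, hq, hk]
    by_cases hn : n < F.length
    · rw [h1, min_eq_left hn.le, List.getD_eq_getElem _ _ hn]
      set m : Fin F.length := ⟨n, hn⟩ with hm
      have hprime : F[n].1.Prime := (hF.1 _ (F.getElem_mem hn)).1
      have hk0 : F[n].2 ≠ 0 := by have := (hF.1 _ (F.getElem_mem hn)).2; omega
      have := Fact.mk hprime
      have hQ : powMod (N + 1) F[n].1 F[n].2 = primePower F m :=
        powMod_of_lt (Nat.lt_succ_of_le (Nat.le_of_dvd hN (primePower_dvd hF m)))
      -- The position counter is reduced modulo `N + 1`, which does not change it.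
      have hlen : n + 1 ≤ N := by
        have := two_pow_length_le hF
        have := Nat.lt_two_pow_self (n := F.length)
        omega
      rw [ifz, if_neg hprime.ne_zero, hQ, md_of_lt (by omega)]
      refine ⟨by dsimp only; omega, fun j r s t => ?_⟩
      have hNj : ((N : ℕ) : ZMod (primePower F j)) = 0 :=
        (ZMod.natCast_eq_zero_iff _ _).2 (primePower_dvd hF j)
      have htot : primePower F m / F[n].1 * (F[n].1 - 1) = (primePower F m).totient :=
        totient_eq hk0
      dsimp only
      rw [cast_md hN.ne' hNj, Nat.cast_add, Nat.cast_mul, cast_powMod hN.ne' hNj, htot,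
        cofactor_pow_totient hF, h2]
      have hjm : j = m ↔ (j : ℕ) = n := Fin.ext_iff
      rcases lt_trichotomy (j : ℕ) n with h | h | h
      · rw [if_pos h, if_neg (by rw [hjm]; omega), if_pos (by omega)]; simp
      · obtain rfl := hjm.2 h
        rw [if_neg (by omega), if_pos rfl, if_pos (by omega), zero_add, one_mul]
        rfl
      · rw [if_neg (by omega), if_neg (by rw [hjm]; omega), if_neg (by omega)]; simp
    · rw [h1, min_eq_right (by omega), List.getD_eq_default _ _ le_rfl, ifz, if_pos Prod.fst_zero]
      refine ⟨by omega, fun j r s t => ?_⟩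
      rw [h2, if_pos (by omega), if_pos (by omega)]

theorem cast_splitting (hF : IsPrimeFactorization N F) (c : Fin 4 → Fin 4 → Fin 4 → ZMod N)
    (m : Fin F.length) (r : Fin 4) (s t : Fin 2) :
    (splitting (fun i => (encodeInput N c F).getD i 0) r s t : ZMod (primePower F m)) =
      factorMatrices (fun i => (encodeInput N c F).getD i 0) F m r s t := by
  have h := (iterate_mainStep hF c N.size).2 m r s t
  rw [if_pos] at h
  · exact h
  · exact m.2.trans (Nat.lt_size.2 (two_pow_length_le hF))

end Chinese

/-! ### Reduction of a basis -/

/-- Reducing a basis of the matrix algebra modulo a divisor. A surjection between finite modules of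
equal cardinality is bijective, so it suffices to see that the reductions span. -/
theorem exists_basis_castHom {N D : ℕ} [NeZero N] (hD : D ∣ N)
    (b : Module.Basis (Fin 4) (ZMod N) (Matrix (Fin 2) (Fin 2) (ZMod N))) :
    ∃ c : Module.Basis (Fin 4) (ZMod D) (Matrix (Fin 2) (Fin 2) (ZMod D)),
      ∀ i, c i = (b i).map (ZMod.castHom hD (ZMod D)) := by
  have : NeZero D := ⟨fun h => NeZero.ne N (by rwa [h, zero_dvd_iff] at hD)⟩
  let f : (Fin 4 → ZMod D) →ₗ[ZMod D] Matrix (Fin 2) (Fin 2) (ZMod D) :=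
    Fintype.linearCombination (ZMod D) fun i => (b i).map (ZMod.castHom hD (ZMod D))
  have hsurj : Function.Surjective f := by
    intro X
    choose g hg using ZMod.castHom_surjective hD
    refine ⟨fun i => ZMod.castHom hD (ZMod D) (b.repr (X.map g) i), ?_⟩
    have h := congrArg (fun Y => Y.map (ZMod.castHom hD (ZMod D))) (b.sum_repr (X.map g))
    ext s t
    have h1 := congrFun (congrFun h s) t
    simp only [Matrix.map_apply, Matrix.sum_apply, Matrix.smul_apply, smul_eq_mul, map_sum, map_mul,
      hg] at h1
    rw [← h1]
    simp only [f, Fintype.linearCombination_apply, Matrix.sum_apply, Matrix.smul_apply,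
      smul_eq_mul, Matrix.map_apply]
  have hcard : Fintype.card (Fin 4 → ZMod D) = Fintype.card (Matrix (Fin 2) (Fin 2) (ZMod D)) := by
    rw [Fintype.card_fun]
    change _ = Fintype.card (Fin 2 → Fin 2 → ZMod D)
    rw [Fintype.card_fun, Fintype.card_fun]
    simp [← pow_mul]
  have hbij := (Fintype.bijective_iff_surjective_and_card f).2 ⟨hsurj, hcard⟩
  refine ⟨.ofEquivFun (LinearEquiv.ofBijective f hbij).symm, fun i => ?_⟩
  simp [f]

/-! ### The splitting of the algebra -/

theorem mod_encodeMatrices {N : ℕ} (X : Fin 4 → Fin 2 → Fin 2 → ℕ) (hN : N ≠ 0) :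
    (List.ofFn fun t : Fin 16 =>
      md (X (Fin.ofNat 4 (t / 4)) (Fin.ofNat 2 (t / 2)) (Fin.ofNat 2 t)) N) =
      encodeMatrices N fun i => Matrix.of fun r s => (X i r s : ZMod N) := by
  have h (x : ℕ) : ((x : ℕ) : ZMod N).val = md x N := by
    rw [ZMod.val_natCast, md, Nat.sub_add_cancel (Nat.pos_of_ne_zero hN)]
  simp only [encodeMatrices, Matrix.of_apply, h]
  rfl

/-- Correctness of the algorithm. The linear map defined by its output is multiplicative and
injective because it is so modulo every prime power, and it is surjective because the algebra
is finite. -/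
theorem exists_algEquiv {N : ℕ} {F : List (ℕ × ℕ)} (hF : IsPrimeFactorization N F) {A : Type*}
    [Ring A] [Algebra (ZMod N) A] (b : Module.Basis (Fin 4) (ZMod N) A)
    (ψ : A ≃+* Matrix (Fin 2) (Fin 2) (ZMod N)) :
    ∃ φ : A ≃ₐ[ZMod N] Matrix (Fin 2) (Fin 2) (ZMod N), ∀ i, φ (b i) = Matrix.of fun r s =>
      (splitting (fun i => (encodeInput N (structureConstants b) F).getD i 0) i r s : ZMod N) := by
  have : NeZero N := ⟨(pos_of_isPrimeFactorization hF).ne'⟩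
  set w : ℕ → ℕ := fun i => (encodeInput N (structureConstants b) F).getD i 0 with hw
  let Ψ : A ≃ₐ[ZMod N] Matrix (Fin 2) (Fin 2) (ZMod N) := AlgEquiv.ofRingEquiv (f := ψ) fun r =>
    RingHom.congr_fun (Subsingleton.elim (ψ.toRingHom.comp (algebraMap (ZMod N) A))
      (algebraMap (ZMod N) (Matrix (Fin 2) (Fin 2) (ZMod N)))) r
  let β := b.map Ψ.toLinearEquiv
  have hβ (i) : β i = Ψ (b i) := rfl
  have htable : IsTable w β := by
    intro i j
    rw [hβ, hβ, ← map_mul, ← b.sum_repr (b i * b j), map_sum]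
    refine Finset.sum_congr rfl fun k _ => ?_
    rw [map_smul, hβ, hw, structConst_encodeInput, ZMod.natCast_zmod_val, structureConstants]
  let π (m : Fin F.length) := ZMod.castHom (primePower_dvd hF m) (ZMod (primePower F m))
  let f : A →ₗ[ZMod N] Matrix (Fin 2) (Fin 2) (ZMod N) :=
    b.constr (ZMod N) fun i => Matrix.of fun r s => (splitting w i r s : ZMod N)
  have hfb (i) : f (b i) = Matrix.of fun r s => (splitting w i r s : ZMod N) :=
    b.constr_basis _ _ i
  -- Modulo each prime power, `f` is the given isomorphism followed by a change of matrix units.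
  have hlocal (m) : ∃ θ : Matrix (Fin 2) (Fin 2) (ZMod (primePower F m)) →ₐ[ZMod (primePower F m)]
      Matrix (Fin 2) (Fin 2) (ZMod (primePower F m)), Function.Injective θ ∧
        ∀ a, (f a).map (π m) = θ ((Ψ a).map (π m)) := by
    have hm := hF.1 _ (F.getElem_mem m.2)
    have := Fact.mk hm.1
    have hk : F[m].2 ≠ 0 := Nat.one_le_iff_ne_zero.1 hm.2
    have hd : F[m].1 ∣ primePower F m := dvd_pow_self _ hk
    obtain ⟨c, hc⟩ := exists_basis_castHom (primePower_dvd hF m) β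
    obtain ⟨d, hd'⟩ := exists_basis_castHom (hd.trans (primePower_dvd hF m)) β
    obtain ⟨θ, hθ, hθ'⟩ := exists_localSplitting (w := w) (b := d) (c := c)
      (Q := primePower F m) (k := F[m].2) rfl hk hd (fun i => by
      ext s t
      rw [hd', Matrix.map_apply, Matrix.map_apply, hc, Matrix.map_apply]
      exact RingHom.congr_fun (Subsingleton.elim _ ((ZMod.castHom hd _).comp (π m))) _)
      (htable.map _ hc)
    refine ⟨θ, hθ, basis_induction b ?_ ?_ ?_ ?_⟩
    · simp
    · intro x y hx hy
      rw [map_add, map_add, Matrix.map_add _ (map_add _), Matrix.map_add _ (map_add _), hx, hy,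
        map_add]
    · intro r x hx
      have hsmul (X : Matrix (Fin 2) (Fin 2) (ZMod N)) : (r • X).map (π m) =
          π m r • X.map (π m) := by ext s t; simp
      rw [map_smul, map_smul, hsmul, hsmul, hx, map_smul]
    · intro i
      ext s t
      rw [hfb, ← hβ, ← hc, ← hθ']
      simp only [Matrix.map_apply, Matrix.of_apply, map_natCast]
      exact cast_splitting hF _ m i s t
  choose θ hθ hfθ using hlocal
  have hone : f 1 = 1 := matrix_eq_of_forall_map_eq hF fun m => by
    rw [hfθ, map_one, Matrix.map_one _ (map_zero _) (map_one _), map_one]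
  have hmul (x y) : f (x * y) = f x * f y := matrix_eq_of_forall_map_eq hF fun m => by
    rw [hfθ, map_mul, Matrix.map_mul, map_mul, ← hfθ, ← hfθ, ← Matrix.map_mul]
  have hinj : Function.Injective f := by
    rw [injective_iff_map_eq_zero]
    intro a ha
    refine (map_eq_zero_iff Ψ Ψ.injective).1 (matrix_eq_of_forall_map_eq hF fun m => ?_)
    refine hθ m ?_
    rw [← hfθ, ha, Matrix.map_zero _ (map_zero _), map_zero]
  have hsurj : Function.Surjective f := by
    have h1 : Function.Injective (f ∘ Ψ.symm) := hinj.comp Ψ.symm.injective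
    exact (Finite.injective_iff_surjective.1 h1).of_comp
  exact ⟨AlgEquiv.ofBijective (AlgHom.ofLinearMap f hone hmul) ⟨hinj, hsurj⟩, hfb⟩

end RAM

theorem mainTheorem10 :
    ∃ (P : RAM.Prog) (T : Polynomial ℕ),
      ∀ (N : ℕ) (F : List (ℕ × ℕ)), IsPrimeFactorization N F →
      ∀ (A : Type*) [Ring A] [Algebra (ZMod N) A] (b : Module.Basis (Fin 4) (ZMod N) A),
        Nonempty (A ≃+* Matrix (Fin 2) (Fin 2) (ZMod N)) →
        ∃ (s : RAM.State) (t : ℕ) (φ : A ≃ₐ[ZMod N] Matrix (Fin 2) (Fin 2) (ZMod N)),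
          RAM.Exec P (RAM.inputState (encodeInput N (structureConstants b) F)) s t ∧
          t ≤ T.eval (RAM.bitLength (encodeInput N (structureConstants b) F)) ∧
          s.output = encodeMatrices N (fun i => φ (b i)) := by
  -- The output lists the entries lexicographically: word `t` is entry `(t / 2 % 2, t % 2)` of
  -- matrix `t / 4`.
  have h : RAM.PolyTime fun (w : ℕ → ℕ) (t : Fin 16) =>
      RAM.md (RAM.splitting w (Fin.ofNat 4 (t / 4)) (Fin.ofNat 2 (t / 2)) (Fin.ofNat 2 t))
        (RAM.readInput w 0) := by
    have := RAM.PolyTime.splitting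
    fun_prop
  obtain ⟨P, T, hPT⟩ := h.exists_prog
  refine ⟨P, T, fun N F hF A _ _ b ⟨ψ⟩ => ?_⟩
  obtain ⟨s, t, he, ht, hs⟩ := hPT (encodeInput N (structureConstants b) F)
  obtain ⟨φ, hφ⟩ := RAM.exists_algEquiv hF b ψ
  refine ⟨s, t, φ, he, ht, ?_⟩
  simp only [hφ]
  rw [hs, ← RAM.mod_encodeMatrices _ (RAM.pos_of_isPrimeFactorization hF).ne']
  rfl
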